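/- **Setting.** Let $n\ge 1$, let $Q$ and $U_0,\dots,U_{n-1}$ be finite-dimensional smooth Riemannian manifolds, $\mathcal U_i\subseteq U_i$ closed sets, $F_i:Q\times U_i\to Q$ maps of class $C^1$, and $q_0\in Q$ a fixed initial state. A sequence $\mathbf u\in\prod_i U_i$ generates states $q_{i+1}=F_i(q_i,u_i)$, $0\le i\le n-1$. Products carry the product Riemannian metrics, and covectors the dual norms. Put $\mathcal U=\prod_i\mathcal U_i\subseteq\prod_i U_i$. Let $E$ be a metric space and let $$\varphi_0:E\times U_0\to\mathbb R,\qquad \varphi_i:E\times (Q\times U_i)\to\mathbb R\ (1\le i\le n-1),\qquad \varphi_n:E\times Q\to\mathbb R$$ be nonnegative and locally Lipschitz in the second variable, uniformly with respect to $e$. Put $S_i(e)=\{x:\varphi_i(e,x)=0\}$, let $\mathcal A(e)$ be the set of $\mathbf u\in\mathcal U$ with $u_0\in S_0(e)$, $(q_i,u_i)\in S_i(e)$ for $1\le i\le n-1$, and $q_n\in S_n(e)$, and let $$P(e,\mathbf u)=\varphi_0(e,u_0)+\varphi_n(e,q_n)+\sum_{i=1}^{n-1}\varphi_i(e,q_i,u_i).$$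 **Nonsmooth notions.** For a lower semicontinuous $f:M\to\mathbb R\cup\{\infty\}$ on a manifold, $p\in T_q^*M$ is a Fréchet subgradient at a point $q$ with $f(q)<\infty$ if $p=dg(q)$ for some $C^1$ function $g:M\to\mathbb R$ such that $f-g$ has a local minimum at $q$. The limiting subdifferential $\partial_Lf(q)$ is the set of limits in $T^*M$ of Fréchet subgradients $p_k$ at points $q_k\to q$ with $f(q_k)\to f(q)$. For a closed set $S\subseteq M$ and $s\in S$, $N^L_S(s)=\partial_L\chi_S(s)$, where $\chi_S$ is $0$ on $S$ and $\infty$ elsewhere, and $T^C_S(s)=\{v\in T_sM:\langle p,v\rangle\le0\ \text{for all } p\in N_S^L(s)\}$. The closed set $S$ is *Clarke regular* if for all $s\in S$, $v\in T^C_S(s)$ and $s_k\to s$ in $S$ there are $v_k\in T^C_S(s_k)$ with $v_k\to v$ in $TM$. **Regularity of constraints.** For $\varphi:E\times M\to\mathbb R$ and $S(e)=\{x:\varphi(e,x)=0\}$, the set $S(e_0)$ is *$\varphi$-regular* at $x_0\in S(e_0)$ if (i) there are $\varepsilon,\Delta>0$ such that $\|p\|\ge\Delta$ whenever $d_E(e,e_0)+d_M(x,x_0)<\varepsilon$,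 $\varphi(e,x)>0$ and $p\in\partial_L\varphi(e,\cdot)(x)$; and (ii) whenever $(e_k,x_k)\to(e_0,x_0)$ and $p_k\in\partial_L\varphi(e_k,\cdot)(x_k)$, some subsequence of $(p_k)$ converges to an element of $\partial_L\varphi(e_0,\cdot)(x_0)$. The constraints are *$\varphi_i$-regular along* $\mathbf u\in\mathcal A(e)$ if $S_0(e)$ is $\varphi_0$-regular at $u_0$, $S_i(e)$ is $\varphi_i$-regular at $(q_i,u_i)$ for $1\le i\le n-1$, and $S_n(e)$ is $\varphi_n$-regular at $q_n$. **Strict normality.** A control $\mathbf u\in\mathcal A(e)$ with states $\mathbf q$ is *strictly $\varphi_i$-normal* if the only sequences $b_0\in\partial_L\varphi_0(e,\cdot)(u_0)$, $(a_i,b_i)\in\partial_L\varphi_i(e,\cdot,\cdot)(q_i,u_i)$ for $1\le i\le n-1$, $a_n\in\partial_L\varphi_n(e,\cdot)(q_n)$, for which the costates $p_i\in T^*_{q_i}Q$ ($1\le i\le n$) defined by $$-p_n=a_n,\qquad p_{i-1}=-a_{i-1}+D_qF_{i-1}(q_{i-1},u_{i-1})^*p_i\quad(2\le i\le n)$$ satisfy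 $$0\le\langle b_{i-1}-D_uF_{i-1}(q_{i-1},u_{i-1})^*p_i,\,v\rangle\qquad\text{for all } v\in T^C_{\mathcal U_{i-1}}(u_{i-1}),\ 1\le i\le n,$$ are $\mathbf a\equiv0$ and $\mathbf b\equiv0$. **Theorem.** Let $\bar e\in E$ and $\bar{\mathbf u}\in\mathcal A(\bar e)$. Suppose that the sets $\mathcal U_i$ are Clarke regular, that the constraints are $\varphi_i$-regular along $\bar{\mathbf u}$ (at the parameter $\bar e$), and that $\bar{\mathbf u}$ is strictly $\varphi_i$-normal. Then $P$ satisfies the strong decrease condition for $\mathcal U$ near $(\bar e,\bar{\mathbf u})$: there exist $\varepsilon,\Delta>0$ such that for every $(e,\mathbf u)\in E\times\mathcal U$ with $P(e,\mathbf u)>0$ and $d(\mathbf u,\bar{\mathbf u})+d_E(e,\bar e)<\varepsilon$ there is a nonzero $\mathbf v\in T^C_{\mathcal U}(\mathbf u)$ such that $$\liminf_{\lambda\downarrow0}\frac{P(e,c(\lambda))-P(e,\mathbf u)}{\lambda}\le-\Delta\|\mathbf v\|$$ for every smooth curve $c:\mathbb R\to\prod_iU_i$ with $c(0)=\mathbf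 u$ and $c'(0)=\mathbf v$. -/

import Mathlib

open scoped Manifold ContDiff Topology Bundle ENNReal
open Filter Set Bundle Bornology

noncomputable section

namespace DiscreteControl

/-! ### Products of smooth and Riemannian manifolds -/

section Pi

variable {ι : Type*} [Fintype ι] {E : ι → Type*} [∀ i, NormedAddCommGroup (E i)]
  [∀ i, NormedSpace ℝ (E i)] {H : ι → Type*} [∀ i, TopologicalSpace (H i)]
  (I : ∀ i, ModelWithCorners ℝ (E i) (H i))
  {M : ι → Type*} [∀ i, TopologicalSpace (M i)] [∀ i, ChartedSpace (H i) (M i)]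

/-- A finite product of manifolds is a manifold. -/
instance isManifoldPi (n : ℕ∞ω) [∀ i, IsManifold (I i) n (M i)] :
    IsManifold (ModelWithCorners.pi I) n (∀ i, M i) := by
  apply isManifold_of_contDiffOn
  rintro _ _ ⟨e, he, rfl⟩ ⟨e', he', rfl⟩
  rw [contDiffOn_pi]
  intro i
  have h := (contDiffGroupoid n (I i)).compatible (he i trivial) (he' i trivial)
  rw [contDiffGroupoid, mem_groupoid_of_pregroupoid] at h
  have h1 : ContDiffOn ℝ n (I i ∘ ((e i).symm ≫ₕ e' i) ∘ (I i).symm)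
    ((I i).symm ⁻¹' ((e i).symm ≫ₕ e' i).source ∩ range (I i)) := h.1
  have h2 : ContDiff ℝ n (fun x : (∀ i, E i) => x i) :=
    (ContinuousLinearMap.proj (R := ℝ) (φ := E) i).contDiff
  refine h1.comp h2.contDiffOn ?_
  rintro x ⟨⟨hx1, hx2⟩, ⟨y, rfl⟩⟩
  exact ⟨⟨hx1 i trivial, hx2 i trivial⟩, ⟨y i, rfl⟩⟩

/-- The `i`-th component `v ↦ v i` of a tangent vector to a product manifold. -/
def piTangentProj (u : ∀ i, M i) (i : ι) :
    TangentSpace (ModelWithCorners.pi I) u →L[ℝ] TangentSpace (I i) (u i) :=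
  ContinuousLinearMap.proj (R := ℝ) (φ := E) i

variable [h : ∀ i, RiemannianBundle (fun x : M i => TangentSpace (I i) x)]

/-- The product inner product `∑ i, g i (v i, w i)`. -/
def piInner (u : ∀ i, M i) : TangentSpace (ModelWithCorners.pi I) u →L[ℝ]
    TangentSpace (ModelWithCorners.pi I) u →L[ℝ] ℝ :=
  ∑ i, (ContinuousLinearMap.precomp ℝ (piTangentProj I u i)) ∘L
    ((h i).g.inner (u i)) ∘L (piTangentProj I u i)

theorem piInner_apply (u : ∀ i, M i) (v w : TangentSpace (ModelWithCorners.pi I) u) :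
    piInner I u v w = ∑ i, (h i).g.inner (u i) (piTangentProj I u i v) (piTangentProj I u i w) := by
  simp [piInner]

/-- The product metric `g(v, w) = ∑ i, g i (v i, w i)` on a finite product of manifolds. -/
def piMetric :
    RiemannianMetric (fun u : (∀ i, M i) => TangentSpace (ModelWithCorners.pi I) u) where
  inner u := piInner I u
  symm u v w := by simp [piInner_apply, (h _).g.symm]
  pos u v hv := by
    have h0 : ∃ i, piTangentProj I u i v ≠ 0 := by
      by_contra! hc
      exact hv (funext hc)
    obtain ⟨i, hi⟩ := h0
    rw [piInner_apply]
    refine Finset.sum_pos' (fun j _ => ?_) ⟨i, Finset.mem_univ _, (h i).g.pos _ _ hi⟩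
    by_cases hj : piTangentProj I u j v = 0
    · simp [hj]
    · exact ((h j).g.pos _ _ hj).le
  continuousAt u := by
    simp only [piInner_apply]
    refine tendsto_finsetSum _ (fun i _ => ?_)
    have := (h i).g.continuousAt (u i)
    refine ContinuousAt.comp (f := piTangentProj I u i)
      (g := fun w => (h i).g.inner (u i) w w) ?_ (piTangentProj I u i).continuous.continuousAt
    simpa using this
  isVonNBounded u := by
    refine (isVonNBounded_pi_iff (E := fun i => TangentSpace (I i) (u i))).2 (fun i => ?_)
    refine ((h i).g.isVonNBounded (u i)).subset ?_
    rintro _ ⟨v, hv, rfl⟩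
    refine lt_of_le_of_lt ?_ ((piInner_apply I u v v).symm.trans_lt hv)
    refine Finset.single_le_sum
      (f := fun j => (h j).g.inner (u j) (piTangentProj I u j v) (piTangentProj I u j v))
      (fun j _ => ?_) (Finset.mem_univ i)
    by_cases hj : piTangentProj I u j v = 0
    · simp [hj]
    · exact ((h j).g.pos _ _ hj).le

instance instRiemannianBundlePi :
    RiemannianBundle (fun u : (∀ i, M i) => TangentSpace (ModelWithCorners.pi I) u) :=
  ⟨piMetric I⟩

end Pi

section Prod

variable {E E' H H' M M' : Type*} [NormedAddCommGroup E] [NormedSpace ℝ E]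
  [NormedAddCommGroup E'] [NormedSpace ℝ E'] [TopologicalSpace H] [TopologicalSpace H']
  (I : ModelWithCorners ℝ E H) (I' : ModelWithCorners ℝ E' H')
  [TopologicalSpace M] [ChartedSpace H M] [TopologicalSpace M'] [ChartedSpace H' M']

/-- The first component of a tangent vector to `M × M'`. -/
def tangentFst (x : M × M') : TangentSpace (I.prod I') x →L[ℝ] TangentSpace I x.1 :=
  ContinuousLinearMap.fst ℝ E E'

/-- The second component of a tangent vector to `M × M'`. -/
def tangentSnd (x : M × M') : TangentSpace (I.prod I') x →L[ℝ] TangentSpace I' x.2 :=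
  ContinuousLinearMap.snd ℝ E E'

variable [h : RiemannianBundle (fun x : M => TangentSpace I x)]
  [h' : RiemannianBundle (fun x : M' => TangentSpace I' x)]

/-- The product metric on `M × M'`. -/
def prodMetric : RiemannianMetric (fun x : M × M' => TangentSpace (I.prod I') x) where
  inner x :=
    (ContinuousLinearMap.precomp ℝ (tangentFst I I' x)) ∘L (h.g.inner x.1) ∘L (tangentFst I I' x)
    + (ContinuousLinearMap.precomp ℝ (tangentSnd I I' x)) ∘L (h'.g.inner x.2) ∘L
        (tangentSnd I I' x)
  symm x v w := by simp [h.g.symm, h'.g.symm]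
  pos x v hv := by
    have k1 : 0 ≤ h.g.inner x.1 (tangentFst I I' x v) (tangentFst I I' x v) := by
      by_cases hj : tangentFst I I' x v = 0
      · simp [hj]
      · exact (h.g.pos _ _ hj).le
    have k2 : 0 ≤ h'.g.inner x.2 (tangentSnd I I' x v) (tangentSnd I I' x v) := by
      by_cases hj : tangentSnd I I' x v = 0
      · simp [hj]
      · exact (h'.g.pos _ _ hj).le
    change 0 < h.g.inner x.1 (tangentFst I I' x v) (tangentFst I I' x v)
      + h'.g.inner x.2 (tangentSnd I I' x v) (tangentSnd I I' x v)
    by_cases h1 : tangentFst I I' x v = 0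
    · have h2 : tangentSnd I I' x v ≠ 0 := fun h2 => hv (Prod.ext h1 h2)
      exact add_pos_of_nonneg_of_pos k1 (h'.g.pos _ _ h2)
    · exact add_pos_of_pos_of_nonneg (h.g.pos _ _ h1) k2
  continuousAt x := by
    have c1 : ContinuousAt (fun v : TangentSpace (I.prod I') x =>
        h.g.inner x.1 (tangentFst I I' x v) (tangentFst I I' x v)) 0 := by
      refine ContinuousAt.comp (f := tangentFst I I' x)
        (g := fun w => h.g.inner x.1 w w) ?_ (tangentFst I I' x).continuous.continuousAt
      simpa using h.g.continuousAt x.1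
    have c2 : ContinuousAt (fun v : TangentSpace (I.prod I') x =>
        h'.g.inner x.2 (tangentSnd I I' x v) (tangentSnd I I' x v)) 0 := by
      refine ContinuousAt.comp (f := tangentSnd I I' x)
        (g := fun w => h'.g.inner x.2 w w) ?_ (tangentSnd I I' x).continuous.continuousAt
      simpa using h'.g.continuousAt x.2
    exact c1.add c2
  isVonNBounded x := by
    have b1 := h.g.isVonNBounded x.1
    have b2 := h'.g.isVonNBounded x.2
    have i1 := b1.image (ContinuousLinearMap.inl ℝ E E' :
      TangentSpace I x.1 →L[ℝ] TangentSpace (I.prod I') x)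
    have i2 := b2.image (ContinuousLinearMap.inr ℝ E E' :
      TangentSpace I' x.2 →L[ℝ] TangentSpace (I.prod I') x)
    refine (i1.add i2).subset ?_
    intro v hv
    have hv' : h.g.inner x.1 (tangentFst I I' x v) (tangentFst I I' x v)
      + h'.g.inner x.2 (tangentSnd I I' x v) (tangentSnd I I' x v) < 1 := hv
    have k1 : 0 ≤ h.g.inner x.1 (tangentFst I I' x v) (tangentFst I I' x v) := by
      by_cases hj : tangentFst I I' x v = 0
      · simp [hj]
      · exact (h.g.pos _ _ hj).le
    have k2 : 0 ≤ h'.g.inner x.2 (tangentSnd I I' x v) (tangentSnd I I' x v) := by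
      by_cases hj : tangentSnd I I' x v = 0
      · simp [hj]
      · exact (h'.g.pos _ _ hj).le
    refine Set.mem_add.mpr ⟨_, ⟨tangentFst I I' x v, ?_, rfl⟩, _,
      ⟨tangentSnd I I' x v, ?_, rfl⟩, ?_⟩
    · exact lt_of_le_of_lt (le_add_of_nonneg_right k2) hv'
    · exact lt_of_le_of_lt (le_add_of_nonneg_left k1) hv'
    · exact Prod.ext (add_zero v.1) (zero_add v.2)

instance instRiemannianBundleProd :
    RiemannianBundle (fun x : M × M' => TangentSpace (I.prod I') x) :=
  ⟨prodMetric I I'⟩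

end Prod

/-! ### Nonsmooth analysis on manifolds -/

section Nonsmooth

variable {E H M : Type*} [NormedAddCommGroup E] [NormedSpace ℝ E] [TopologicalSpace H]
  (I : ModelWithCorners ℝ E H) [TopologicalSpace M] [ChartedSpace H M]

/-- The cotangent space `T*_q M`. -/
abbrev Cotangent (q : M) : Type _ := TangentSpace I q →L[ℝ] ℝ

/-- The Fréchet subdifferential of `f : M → ℝ ∪ {∞}` at a point `q` with `f q` finite: all
differentials `dg(q)` of `C¹` functions `g` for which `f - g` has a local minimum at `q`. -/
def frechetSubdiff (f : M → EReal) (q : M) : Set (Cotangent I q) :=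
  {p | (∃ r : ℝ, f q = r) ∧ ∃ g : M → ℝ, ContMDiff I 𝓘(ℝ, ℝ) 1 g ∧
    mfderiv I 𝓘(ℝ, ℝ) g q = p ∧ IsLocalMin (fun x => f x - (g x : EReal)) q}

/-- `c` is a smooth curve with `c 0 = q` and `c' 0 = v`. -/
def IsSmoothCurveWithVelocity (c : ℝ → M) (q : M) (v : TangentSpace I q) : Prop :=
  ContMDiff 𝓘(ℝ, ℝ) I ∞ c ∧ c 0 = q ∧ (mfderiv 𝓘(ℝ, ℝ) I c 0 (1 : ℝ) : E) = v

/-- The lower limit of `(f (c t) - f (c 0)) / t` as `t ↓ 0`, in the extended reals. -/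
def lowerDiniAlong (f : M → ℝ) (c : ℝ → M) : EReal :=
  liminf (fun t : ℝ => (((f (c t) - f (c 0)) / t : ℝ) : EReal)) (𝓝[>] 0)

variable {P : Type*}

/-- `φ : P × M → ℝ` is nonnegative and locally Lipschitz in the second variable (in a coordinate
chart), uniformly with respect to the first. -/
structure IsConstraintFunction (φ : P → M → ℝ) : Prop where
  nonneg : ∀ e x, 0 ≤ φ e x
  locallyLipschitz : ∀ x : M, ∃ K, ∃ t ∈ 𝓝[range I] (extChartAt I x x),
    ∀ e, LipschitzOnWith K (φ e ∘ (extChartAt I x).symm) t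

/-- The set `S(e) = {x | φ(e, x) = 0}` characterized by `φ`. -/
def constraintSet (φ : P → M → ℝ) (e : P) : Set M := {x | φ e x = 0}

variable [IsManifold I 1 M]

/-- Convergence `p k → p` in the cotangent bundle, where `p k` is a covector at `x k` and `p` a
covector at `q`. -/
def TendstoCovector (x : ℕ → M) (ξ : ∀ k, Cotangent I (x k)) (q : M) (p : Cotangent I q) : Prop :=
  Tendsto (fun k => (⟨x k, ξ k⟩ :
      TotalSpace (E →L[ℝ] ℝ) (fun y : M => TangentSpace I y →L[ℝ] ℝ))) atTop (𝓝 ⟨q, p⟩)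

/-- The limiting subdifferential. -/
def limitingSubdiff (f : M → EReal) (q : M) : Set (Cotangent I q) :=
  {p | ∃ (x : ℕ → M) (ξ : ∀ k, Cotangent I (x k)),
    (∀ k, ξ k ∈ frechetSubdiff I f (x k)) ∧ Tendsto x atTop (𝓝 q) ∧
    Tendsto (fun k => f (x k)) atTop (𝓝 (f q)) ∧ TendstoCovector I x ξ q p}

/-- The limiting subdifferential of a real-valued function. -/
def limitingSubdiffReal (f : M → ℝ) (q : M) : Set (Cotangent I q) :=
  limitingSubdiff I (fun x => (f x : EReal)) q

open Classical in
/-- The function `χ_S`, equal to `0` on `S` and to `∞` off `S`. -/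
def chi (S : Set M) (x : M) : EReal := if x ∈ S then 0 else ⊤

/-- The limiting normal cone to `S` at `s`. -/
def limitingNormalCone (S : Set M) (s : M) : Set (Cotangent I s) :=
  limitingSubdiff I (chi S) s

/-- The Clarke tangent cone to `S` at `s`: the polar of the limiting normal cone. -/
def clarkeTangentCone (S : Set M) (s : M) : Set (TangentSpace I s) :=
  {v | ∀ p ∈ limitingNormalCone I S s, p v ≤ 0}

/-- Clarke regularity of a closed set: every `v ∈ T_S^C(s)` is, along every sequence `s k → s` in
`S`, the limit in the tangent bundle of vectors `v k ∈ T_S^C(s k)`. -/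
def ClarkeRegular (S : Set M) : Prop :=
  IsClosed S ∧ ∀ s ∈ S, ∀ v ∈ clarkeTangentCone I S s, ∀ x : ℕ → M, (∀ k, x k ∈ S) →
    Tendsto x atTop (𝓝 s) →
    ∃ w : ∀ k, TangentSpace I (x k), (∀ k, w k ∈ clarkeTangentCone I S (x k)) ∧
      Tendsto (fun k => (⟨x k, w k⟩ : TangentBundle I M)) atTop (𝓝 ⟨s, v⟩)

variable [PseudoMetricSpace P] [RiemannianBundle (fun x : M => TangentSpace I x)]

/-- `S(e₀)` is `φ`-regular at `x₀ ∈ S(e₀)`. Here `Manifold.riemannianEDist` is the distance of the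
Riemannian manifold `M`, and the norm of a covector is the dual norm. -/
structure IsPhiRegular (φ : P → M → ℝ) (e₀ : P) (x₀ : M) : Prop where
  mem : x₀ ∈ constraintSet φ e₀
  norm_ge : ∃ ε > (0 : ℝ), ∃ Δ > (0 : ℝ), ∀ (e : P) (x : M),
    edist e e₀ + Manifold.riemannianEDist I x x₀ < ENNReal.ofReal ε → 0 < φ e x →
    ∀ p ∈ limitingSubdiffReal I (φ e) x, Δ ≤ ‖p‖
  exists_subseq : ∀ (e : ℕ → P) (x : ℕ → M) (ξ : ∀ k, Cotangent I (x k)),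
    Tendsto e atTop (𝓝 e₀) → Tendsto x atTop (𝓝 x₀) →
    (∀ k, ξ k ∈ limitingSubdiffReal I (φ (e k)) (x k)) →
    ∃ σ : ℕ → ℕ, StrictMono σ ∧ ∃ p ∈ limitingSubdiffReal I (φ e₀) x₀,
      TendstoCovector I (fun k => x (σ k)) (fun k => ξ (σ k)) x₀ p

/-- The strong decrease condition for `F : P × M → ℝ` on the closed set `S` near `(e₀, q₀)`. -/
def StrongDecrease (F : P → M → ℝ) (S : Set M) (e₀ : P) (q₀ : M) : Prop :=
  ∃ ε > (0 : ℝ), ∃ Δ > (0 : ℝ), ∀ (e : P), ∀ q ∈ S, 0 < F e q →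
    Manifold.riemannianEDist I q q₀ + edist e e₀ < ENNReal.ofReal ε →
    ∃ v ∈ clarkeTangentCone I S q, v ≠ 0 ∧
      ∀ c : ℝ → M, IsSmoothCurveWithVelocity I c q v →
        lowerDiniAlong (F e) c ≤ ((-(Δ * ‖v‖) : ℝ) : EReal)

end Nonsmooth

/-! ### Discrete-time geometric control systems with mixed constraints -/

section Control

/-- The dynamics and control sets of a discrete-time geometric control system with `m + 1` steps:
closed control sets `𝒰 i ⊆ U i` and `C¹` maps `F i : Q × U i → Q`, for `0 ≤ i ≤ m`. -/
structure ControlSystem (m : ℕ) (EQ : Type*) [NormedAddCommGroup EQ] [NormedSpace ℝ EQ]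
    (Q : Type*) [TopologicalSpace Q] [ChartedSpace EQ Q]
    (EU : Fin (m + 1) → Type*) [∀ i, NormedAddCommGroup (EU i)] [∀ i, NormedSpace ℝ (EU i)]
    (U : Fin (m + 1) → Type*) [∀ i, TopologicalSpace (U i)] [∀ i, ChartedSpace (EU i) (U i)] where
  controlSet : ∀ i, Set (U i)
  isClosed_controlSet : ∀ i, IsClosed (controlSet i)
  F : ∀ i, Q × U i → Q
  contMDiff_F : ∀ i, ContMDiff (𝓘(ℝ, EQ).prod 𝓘(ℝ, EU i)) 𝓘(ℝ, EQ) 1 (F i)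

/-- Functions `φ` characterizing the constraints `u 0 ∈ S 0 (e)`, `(q i, u i) ∈ S i (e)` for
`1 ≤ i ≤ m`, and `q (m + 1) ∈ S (m + 1) (e)`; `mid j` is the function with index `j + 1`. -/
structure ConstraintFunctions (P : Type*) (m : ℕ)
    (EQ : Type*) [NormedAddCommGroup EQ] [NormedSpace ℝ EQ]
    (Q : Type*) [TopologicalSpace Q] [ChartedSpace EQ Q]
    (EU : Fin (m + 1) → Type*) [∀ i, NormedAddCommGroup (EU i)] [∀ i, NormedSpace ℝ (EU i)]
    (U : Fin (m + 1) → Type*) [∀ i, TopologicalSpace (U i)] [∀ i, ChartedSpace (EU i) (U i)] where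
  initial : P → U 0 → ℝ
  mid : ∀ j : Fin m, P → Q × U j.succ → ℝ
  final : P → Q → ℝ
  initial_spec : IsConstraintFunction 𝓘(ℝ, EU 0) initial
  mid_spec : ∀ j, IsConstraintFunction (𝓘(ℝ, EQ).prod 𝓘(ℝ, EU j.succ)) (mid j)
  final_spec : IsConstraintFunction 𝓘(ℝ, EQ) final

variable {P : Type*} [PseudoMetricSpace P] {m : ℕ}
  {EQ : Type*} [NormedAddCommGroup EQ] [NormedSpace ℝ EQ]
  {Q : Type*} [TopologicalSpace Q] [ChartedSpace EQ Q]
  {EU : Fin (m + 1) → Type*} [∀ i, NormedAddCommGroup (EU i)] [∀ i, NormedSpace ℝ (EU i)]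
  {U : Fin (m + 1) → Type*} [∀ i, TopologicalSpace (U i)] [∀ i, ChartedSpace (EU i) (U i)]

/-- The set of control sequences, as a subset of the product manifold `∏ i, U i`. -/
def ControlSystem.controls (sys : ControlSystem m EQ Q EU U) : Set (∀ i, U i) :=
  {u | ∀ i, u i ∈ sys.controlSet i}

/-- The state sequence `q 0 = q₀`, `q (i + 1) = F i (q i, u i)`. -/
def ControlSystem.state (sys : ControlSystem m EQ Q EU U) (q₀ : Q) (u : ∀ i, U i) :
    Fin (m + 2) → Q :=
  Fin.induction q₀ (fun i q => sys.F i (q, u i))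

/-- The set `𝒜(e)` of control sequences which, with their state sequences, satisfy the
constraints. -/
def feasible (sys : ControlSystem m EQ Q EU U) (Φ : ConstraintFunctions P m EQ Q EU U) (q₀ : Q)
    (e : P) : Set (∀ i, U i) :=
  {u | u ∈ sys.controls ∧ u 0 ∈ constraintSet Φ.initial e ∧
    (∀ j : Fin m, (sys.state q₀ u j.succ.castSucc, u j.succ) ∈ constraintSet (Φ.mid j) e) ∧
    sys.state q₀ u (Fin.last (m + 1)) ∈ constraintSet Φ.final e}

/-- The penalty function. -/
def penalty (sys : ControlSystem m EQ Q EU U) (Φ : ConstraintFunctions P m EQ Q EU U) (q₀ : Q)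
    (e : P) (u : ∀ i, U i) : ℝ :=
  Φ.initial e (u 0) + Φ.final e (sys.state q₀ u (Fin.last (m + 1))) +
    ∑ j : Fin m, Φ.mid j e (sys.state q₀ u j.succ.castSucc, u j.succ)

/-- The constraints are `φ i`-regular along `u` (at the parameter `e`). -/
structure IsRegularAlong [IsManifold 𝓘(ℝ, EQ) 1 Q] [∀ i, IsManifold 𝓘(ℝ, EU i) 1 (U i)]
    [RiemannianBundle (fun x : Q => TangentSpace 𝓘(ℝ, EQ) x)]
    [∀ i, RiemannianBundle (fun x : U i => TangentSpace 𝓘(ℝ, EU i) x)]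
    (sys : ControlSystem m EQ Q EU U) (Φ : ConstraintFunctions P m EQ Q EU U) (q₀ : Q)
    (e : P) (u : ∀ i, U i) : Prop where
  initial : IsPhiRegular 𝓘(ℝ, EU 0) Φ.initial e (u 0)
  mid : ∀ j : Fin m, IsPhiRegular (𝓘(ℝ, EQ).prod 𝓘(ℝ, EU j.succ)) (Φ.mid j) e
    (sys.state q₀ u j.succ.castSucc, u j.succ)
  final : IsPhiRegular 𝓘(ℝ, EQ) Φ.final e (sys.state q₀ u (Fin.last (m + 1)))

/-- The multiplier conditions in the definition of strict normality, for sequences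
`a 1, …, a n`, `b 0, …, b (n - 1)`, `p 1, …, p n` with `n = m + 1`. In the code, `a i` and `p i`
stand for the covectors with index `i + 1`, based at the state `q (i + 1)`. -/
structure IsMultiplier [IsManifold 𝓘(ℝ, EQ) 1 Q] [∀ i, IsManifold 𝓘(ℝ, EU i) 1 (U i)]
    (sys : ControlSystem m EQ Q EU U) (Φ : ConstraintFunctions P m EQ Q EU U) (q₀ : Q)
    (e : P) (u : ∀ i, U i)
    (a p : ∀ i : Fin (m + 1), Cotangent 𝓘(ℝ, EQ) (sys.state q₀ u i.succ))
    (b : ∀ i : Fin (m + 1), Cotangent 𝓘(ℝ, EU i) (u i)) : Prop where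
  initial : b 0 ∈ limitingSubdiffReal 𝓘(ℝ, EU 0) (Φ.initial e) (u 0)
  mid : ∀ j : Fin m,
    (a j.castSucc).comp
        (tangentFst 𝓘(ℝ, EQ) 𝓘(ℝ, EU j.succ) (sys.state q₀ u j.succ.castSucc, u j.succ)) +
      (b j.succ).comp
        (tangentSnd 𝓘(ℝ, EQ) 𝓘(ℝ, EU j.succ) (sys.state q₀ u j.succ.castSucc, u j.succ)) ∈
      limitingSubdiffReal (𝓘(ℝ, EQ).prod 𝓘(ℝ, EU j.succ)) (Φ.mid j e)
        (sys.state q₀ u j.succ.castSucc, u j.succ)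
  final : a (Fin.last m) ∈
    limitingSubdiffReal 𝓘(ℝ, EQ) (Φ.final e) (sys.state q₀ u (Fin.last (m + 1)))
  endpoint : -p (Fin.last m) = a (Fin.last m)
  adjoint : ∀ (j : Fin m) (w : TangentSpace 𝓘(ℝ, EQ) (sys.state q₀ u j.succ.castSucc)),
    p j.castSucc w = -a j.castSucc w +
      p j.succ (mfderiv 𝓘(ℝ, EQ) 𝓘(ℝ, EQ) (fun q => sys.F j.succ (q, u j.succ))
        (sys.state q₀ u j.succ.castSucc) w)
  maximum : ∀ i : Fin (m + 1), ∀ v ∈ clarkeTangentCone 𝓘(ℝ, EU i) (sys.controlSet i) (u i),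
    0 ≤ (b i - (p i).comp (mfderiv 𝓘(ℝ, EU i) 𝓘(ℝ, EQ)
      (fun c => sys.F i (sys.state q₀ u i.castSucc, c)) (u i))) v

/-- Strict normality: the only multipliers `a`, `b` are zero. -/
def IsStrictlyNormal [IsManifold 𝓘(ℝ, EQ) 1 Q] [∀ i, IsManifold 𝓘(ℝ, EU i) 1 (U i)]
    (sys : ControlSystem m EQ Q EU U) (Φ : ConstraintFunctions P m EQ Q EU U) (q₀ : Q)
    (e : P) (u : ∀ i, U i) : Prop :=
  ∀ a p b, IsMultiplier sys Φ q₀ e u a p b → (∀ i, a i = 0) ∧ ∀ i, b i = 0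

end Control

end DiscreteControl

end

/-! Each summand of `penalty` is a constraint function composed with a `C¹` map of the control
sequence: the first control, a pair (state, control), or the final state. The theorem is an instance
of a criterion for such composites, `strongDecrease_of_forall_multiplier_eq_zero`, whose hypothesis
on multipliers is strict normality in disguise (`IsStrictlyNormal.eq_zero`).

The criterion is proved by contradiction. If strong decrease fails, there are parameters and
controls `(e k, u k)` converging to the reference pair, with positive penalty, such that every
nonzero `v` in the Clarke tangent cone at `u k` is the velocity of a curve along which the penalty
decreases more slowly than `‖v‖ / (k + 1)`. A penalized minimization
(`exists_subgradient_of_increment_ge`) converts this into a smooth function touching the sum from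
below near `u k`, with derivative almost nonnegative on the image of the cone. The arguments of the
summands are treated there as independent variables, so the touching function restricts to one for
each summand (`exists_decoupled_subgradients`), and no sum or chain rule for subdifferentials is
needed. The price is that each summand has its own test point, only close to its argument at `u k`;
it is chosen so close that a positive value stays positive.

Part (ii) of `φ`-regularity makes the subgradients converge along a subsequence. Clarke regularity
approximates every tangent vector at the reference control by tangent vectors at `u k`, so the
limits satisfy a multiplier inequality. Summation by parts against the costate (`sum_costate_eq`)
identifies it with the conditions of strict normality, and all limits vanish. The subgradients thus
become small, and part (i) of `φ`-regularity forces each summand to vanish at its test point. Hence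
no summand was positive at `u k`, although their sum was. -/

noncomputable section

namespace DiscreteControl

/-! ### Convergence in the tangent and cotangent bundles, in coordinates -/

section Coordinates

variable {E H M : Type*} [NormedAddCommGroup E] [NormedSpace ℝ E] [TopologicalSpace H]
  (I : ModelWithCorners ℝ E H) [TopologicalSpace M] [ChartedSpace H M] [IsManifold I 1 M]

/-- The trivialization at the limit point turns bundle convergence into convergence in the base and
in the fixed space `E`. -/
theorem tendsto_tangentBundle_iff {α : Type*} {l : Filter α} (x : α → M)
    (w : ∀ k, TangentSpace I (x k)) (s : M) (v : TangentSpace I s) :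
    Tendsto (fun k => (⟨x k, w k⟩ : TangentBundle I M)) l (𝓝 ⟨s, v⟩) ↔
      Tendsto x l (𝓝 s) ∧
        Tendsto (fun k => (tangentCoordChange I (x k) s (x k) (w k) : E)) l (𝓝 (v : E)) := by
  rw [(trivializationAt E (TangentSpace I) s).tendsto_nhds_iff
    (FiberBundle.mem_trivializationAt_proj_source (x := ⟨s, v⟩))]
  have h : ((trivializationAt E (TangentSpace I) s) ⟨s, v⟩).2 = (v : E) :=
    (tangentBundleCore I M).coordChange_self (achart H s) s (mem_achart_source H s) v
  rw [h]
  rfl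

/-- Covectors transform contravariantly to vectors, so the coordinate change runs from the chart at
the limit `s` to the chart at `x k`. -/
theorem tendstoCovector_iff (x : ℕ → M) (ξ : ∀ k, Cotangent I (x k)) (s : M) (p : Cotangent I s) :
    TendstoCovector I x ξ s p ↔ Tendsto x atTop (𝓝 s) ∧
      Tendsto (fun k => (show E →L[ℝ] ℝ from ξ k) ∘L tangentCoordChange I s (x k) (x k)) atTop
        (𝓝 (show E →L[ℝ] ℝ from p)) := by
  unfold TendstoCovector
  rw [(trivializationAt (E →L[ℝ] ℝ) (fun y : M => TangentSpace I y →L[ℝ] ℝ) s).tendsto_nhds_iff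
    (FiberBundle.mem_trivializationAt_proj_source (x := ⟨s, p⟩))]
  have key : ∀ (y : M) (q : TangentSpace I y →L[ℝ] ℝ), y ∈ (chartAt H s).source →
      ((trivializationAt (E →L[ℝ] ℝ) (fun y : M => TangentSpace I y →L[ℝ] ℝ) s) ⟨y, q⟩).2 =
        (show E →L[ℝ] ℝ from q) ∘L tangentCoordChange I s y y := by
    intro y q hy
    rw [hom_trivializationAt_apply]
    ext v
    simp only [ContinuousLinearMap.inCoordinates]
    rw [TangentBundle.symmL_trivializationAt_eq_core hy]
    simp
    rfl
  have h : ((trivializationAt (E →L[ℝ] ℝ) (fun y : M => TangentSpace I y →L[ℝ] ℝ) s) ⟨s, p⟩).2 =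
      (show E →L[ℝ] ℝ from p) := by
    rw [key s p (mem_chart_source H s)]
    ext v
    exact congrArg (show E →L[ℝ] ℝ from p)
      ((tangentBundleCore I M).coordChange_self (achart H s) s (mem_achart_source H s) v)
  rw [h]
  refine and_congr_right fun hx => tendsto_congr' ?_
  filter_upwards [hx ((chartAt H s).open_source.mem_nhds (mem_chart_source H s))] with k hk
  exact key _ _ hk

end Coordinates

/-! ### Coordinate changes on products -/

section Prod

variable {E E' H H' M M' : Type*} [NormedAddCommGroup E] [NormedSpace ℝ E]
  [NormedAddCommGroup E'] [NormedSpace ℝ E'] [TopologicalSpace H] [TopologicalSpace H']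
  (I : ModelWithCorners ℝ E H) (I' : ModelWithCorners ℝ E' H')
  [TopologicalSpace M] [ChartedSpace H M] [TopologicalSpace M'] [ChartedSpace H' M']
  [IsManifold I 1 M] [IsManifold I' 1 M']

/-- Both sides are derivatives, within the range of the model, of the same chart transition, and
that range has unique derivatives. The finite product is treated in the same way. -/
theorem tangentCoordChange_prod (x y z : M × M')
    (hx : z ∈ (extChartAt (I.prod I') x).source) (hy : z ∈ (extChartAt (I.prod I') y).source) :
    tangentCoordChange (I.prod I') x y z =
      (tangentCoordChange I x.1 y.1 z.1).prodMap (tangentCoordChange I' x.2 y.2 z.2) := by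
  have h := hasFDerivWithinAt_tangentCoordChange (I := I.prod I') ⟨hx, hy⟩
  have hx' := hx
  have hy' := hy
  rw [extChartAt_prod] at hx' hy'
  have h1 := hasFDerivWithinAt_tangentCoordChange (I := I) ⟨hx'.1, hy'.1⟩
  have h2 := hasFDerivWithinAt_tangentCoordChange (I := I') ⟨hx'.2, hy'.2⟩
  have hr : range (I.prod I') = range I ×ˢ range I' := by
    rw [modelWithCorners_prod_coe, Set.range_prodMap]
  have e1 : HasFDerivWithinAt (extChartAt I y.1 ∘ (extChartAt I x.1).symm ∘ Prod.fst)
      (tangentCoordChange I x.1 y.1 z.1 ∘L ContinuousLinearMap.fst ℝ E E')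
      (range (I.prod I')) (extChartAt I x.1 z.1, extChartAt I' x.2 z.2) := by
    refine HasFDerivWithinAt.comp (t := range I) (f := (Prod.fst : E × E' → E))
      (extChartAt I x.1 z.1, extChartAt I' x.2 z.2) h1 hasFDerivWithinAt_fst ?_
    rw [hr]; exact fun v hv => hv.1
  have e2 : HasFDerivWithinAt (extChartAt I' y.2 ∘ (extChartAt I' x.2).symm ∘ Prod.snd)
      (tangentCoordChange I' x.2 y.2 z.2 ∘L ContinuousLinearMap.snd ℝ E E')
      (range (I.prod I')) (extChartAt I x.1 z.1, extChartAt I' x.2 z.2) := by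
    refine HasFDerivWithinAt.comp (t := range I') (f := (Prod.snd : E × E' → E'))
      (extChartAt I x.1 z.1, extChartAt I' x.2 z.2) h2 hasFDerivWithinAt_snd ?_
    rw [hr]; exact fun v hv => hv.2
  have hu : UniqueDiffWithinAt ℝ (range (I.prod I')) (extChartAt (I.prod I') x z) :=
    (I.prod I').uniqueDiffOn _ (mem_range_self _)
  refine hu.eq h ?_
  simp only [extChartAt_prod]
  exact e1.prodMk e2

end Prod

section Pi

variable {ι : Type*} [Fintype ι] {E : ι → Type*} [∀ i, NormedAddCommGroup (E i)]
  [∀ i, NormedSpace ℝ (E i)] {H : ι → Type*} [∀ i, TopologicalSpace (H i)]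
  (I : ∀ i, ModelWithCorners ℝ (E i) (H i))
  {M : ι → Type*} [∀ i, TopologicalSpace (M i)] [∀ i, ChartedSpace (H i) (M i)]

theorem extChartAt_pi (x : ∀ i, M i) :
    extChartAt (ModelWithCorners.pi I) x = PartialEquiv.pi fun i => extChartAt (I i) (x i) := by
  ext1
  · rfl
  · rfl
  · simp only [extChartAt, OpenPartialHomeomorph.extend]
    ext y
    simp [ModelWithCorners.pi, piChartedSpace_chartAt, OpenPartialHomeomorph.pi]

theorem mem_extChartAt_pi_source (x z : ∀ i, M i) :
    z ∈ (extChartAt (ModelWithCorners.pi I) x).source ↔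
      ∀ i, z i ∈ (extChartAt (I i) (x i)).source := by
  rw [extChartAt_pi]; simp [PartialEquiv.pi]

theorem range_pi : range (ModelWithCorners.pi I) = Set.pi univ fun i => range (I i) :=
  Set.range_piMap fun i => (I i : H i → E i)

variable [∀ i, IsManifold (I i) 1 (M i)]

theorem tangentCoordChange_pi (x y z : ∀ i, M i)
    (hx : z ∈ (extChartAt (ModelWithCorners.pi I) x).source)
    (hy : z ∈ (extChartAt (ModelWithCorners.pi I) y).source) (v : ∀ i, E i) (i : ι) :
    tangentCoordChange (ModelWithCorners.pi I) x y z v i =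
      tangentCoordChange (I i) (x i) (y i) (z i) (v i) := by
  have h := hasFDerivWithinAt_tangentCoordChange (I := ModelWithCorners.pi I) ⟨hx, hy⟩
  rw [mem_extChartAt_pi_source] at hx hy
  have hu : UniqueDiffWithinAt ℝ (range (ModelWithCorners.pi I))
      (extChartAt (ModelWithCorners.pi I) x z) :=
    (ModelWithCorners.pi I).uniqueDiffOn _ (mem_range_self _)
  have key : tangentCoordChange (ModelWithCorners.pi I) x y z =
      ContinuousLinearMap.pi fun i => (tangentCoordChange (I i) (x i) (y i) (z i)) ∘L
        (ContinuousLinearMap.proj i) := by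
    refine hu.eq h ?_
    rw [hasFDerivWithinAt_pi]
    intro j
    have hj := hasFDerivWithinAt_tangentCoordChange (I := I j) ⟨hx j, hy j⟩
    refine HasFDerivWithinAt.comp (t := range (I j)) (f := fun v : ∀ i, E i => v j)
      (extChartAt (ModelWithCorners.pi I) x z) (g := extChartAt (I j) (y j) ∘ (extChartAt (I j) (x j)).symm) hj
      (ContinuousLinearMap.proj (R := ℝ) (φ := E) j).hasFDerivWithinAt ?_
    intro v hv
    rw [range_pi] at hv
    exact hv j trivial
  rw [key]; rfl

end Pi

/-! ### Continuity of product Riemannian metrics -/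

theorem continuous_bilinearComp_self {E F : Type*} [NormedAddCommGroup E] [NormedSpace ℝ E]
    [NormedAddCommGroup F] [NormedSpace ℝ F] (f : F →L[ℝ] E) :
    Continuous fun B : E →L[ℝ] E →L[ℝ] ℝ => B.bilinearComp f f := by
  have h : Continuous fun B : E →L[ℝ] E →L[ℝ] ℝ =>
      (ContinuousLinearMap.precomp ℝ f) ∘L (B ∘L f) := by fun_prop
  exact h

section Riemannian

variable {E H M : Type*} [NormedAddCommGroup E] [NormedSpace ℝ E] [TopologicalSpace H]
  (I : ModelWithCorners ℝ E H) [TopologicalSpace M] [ChartedSpace H M] [IsManifold I 1 M]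

/-- A bilinear form on `T_y M` in the coordinates given by the preferred chart at `s`. -/
def bilinInChart (g : ∀ y : M, TangentSpace I y →L[ℝ] TangentSpace I y →L[ℝ] ℝ) (s y : M) :
    E →L[ℝ] E →L[ℝ] ℝ :=
  ContinuousLinearMap.bilinearComp (show E →L[ℝ] E →L[ℝ] ℝ from g y)
    (tangentCoordChange I s y y) (tangentCoordChange I s y y)

theorem bilinInChart_apply (g : ∀ y : M, TangentSpace I y →L[ℝ] TangentSpace I y →L[ℝ] ℝ)
    (s y : M) (v w : E) :
    bilinInChart I g s y v w =
      g y (tangentCoordChange I s y y v) (tangentCoordChange I s y y w) := rfl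

/-- Continuity can thus be tested in the fixed space of bilinear forms on `E`, where a product
metric is a sum of pullbacks along the projections. -/
theorem continuousAt_bilin_iff (g : ∀ y : M, TangentSpace I y →L[ℝ] TangentSpace I y →L[ℝ] ℝ)
    (s : M) :
    ContinuousAt (fun y => (TotalSpace.mk' (E →L[ℝ] E →L[ℝ] ℝ) y (g y) :
        TotalSpace (E →L[ℝ] E →L[ℝ] ℝ)
          (fun y : M => TangentSpace I y →L[ℝ] TangentSpace I y →L[ℝ] ℝ))) s ↔
      ContinuousAt (bilinInChart I g s) s := by
  rw [continuousAt_hom_bundle]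
  refine (and_iff_right continuousAt_id).trans (continuousAt_congr ?_)
  filter_upwards [(chartAt H s).open_source.mem_nhds (mem_chart_source H s)] with y hy
  ext v w
  change ContinuousLinearMap.inCoordinates E (fun y : M => TangentSpace I y) (E →L[ℝ] ℝ)
    (fun y : M => TangentSpace I y →L[ℝ] ℝ) s y s y (g y) v w = _
  rw [inCoordinates_apply_eq₂ hy hy (by simp)]
  have h := TangentBundle.symmL_trivializationAt_eq_core (I := I) (b₀ := s) (b := y) hy
  have h1 : ∀ v : E, (trivializationAt E (fun y : M => TangentSpace I y) s).symm y v =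
      (tangentCoordChange I s y y v : E) := by
    intro v
    have := congrArg (fun f : E →L[ℝ] TangentSpace I y => f v) h
    exact (Trivialization.symmL_apply _ hy v).symm.trans this
  rw [h1, h1, bilinInChart_apply]
  simp

variable [h : RiemannianBundle (fun x : M => TangentSpace I x)]

theorem isContinuousRiemannianBundle_iff :
    IsContinuousRiemannianBundle E (fun x : M => TangentSpace I x) ↔
      ∀ s : M, ContinuousAt (bilinInChart I h.g.inner s) s := by
  constructor
  · rintro ⟨g, hg, hi⟩ s
    have : h.g.inner = g := by
      funext x; ext v w; exact hi x v w
    rw [this]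
    exact (continuousAt_bilin_iff I g s).1 hg.continuousAt
  · intro H
    refine ⟨h.g.inner, ?_, fun x v w => rfl⟩
    rw [continuous_iff_continuousAt]
    exact fun s => (continuousAt_bilin_iff I _ s).2 (H s)

end Riemannian

section Prod

variable {E E' H H' M M' : Type*} [NormedAddCommGroup E] [NormedSpace ℝ E]
  [NormedAddCommGroup E'] [NormedSpace ℝ E'] [TopologicalSpace H] [TopologicalSpace H']
  (I : ModelWithCorners ℝ E H) (I' : ModelWithCorners ℝ E' H')
  [TopologicalSpace M] [ChartedSpace H M] [TopologicalSpace M'] [ChartedSpace H' M']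
  [IsManifold I 1 M] [IsManifold I' 1 M']
  [h : RiemannianBundle (fun x : M => TangentSpace I x)]
  [h' : RiemannianBundle (fun x : M' => TangentSpace I' x)]

set_option synthInstance.maxHeartbeats 200000 in
instance isContinuousRiemannianBundle_prod
    [hc : IsContinuousRiemannianBundle E (fun x : M => TangentSpace I x)]
    [hc' : IsContinuousRiemannianBundle E' (fun x : M' => TangentSpace I' x)] :
    IsContinuousRiemannianBundle (E × E') (fun x : M × M' => TangentSpace (I.prod I') x) := by
  rw [isContinuousRiemannianBundle_iff] at *
  intro s
  have e1 : ContinuousAt (fun y : M × M' => bilinInChart I h.g.inner s.1 y.1) s :=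
    ContinuousAt.comp (g := bilinInChart I h.g.inner s.1) (f := Prod.fst) (hc s.1) continuousAt_fst
  have e2 : ContinuousAt (fun y : M × M' => bilinInChart I' h'.g.inner s.2 y.2) s :=
    ContinuousAt.comp (g := bilinInChart I' h'.g.inner s.2) (f := Prod.snd) (hc' s.2) continuousAt_snd
  have c1 : ContinuousAt (fun y : M × M' =>
      (bilinInChart I h.g.inner s.1 y.1).bilinearComp (ContinuousLinearMap.fst ℝ E E')
        (ContinuousLinearMap.fst ℝ E E') +
      (bilinInChart I' h'.g.inner s.2 y.2).bilinearComp (ContinuousLinearMap.snd ℝ E E')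
        (ContinuousLinearMap.snd ℝ E E')) s := by
    exact ((continuous_bilinearComp_self _).continuousAt.comp e1).add
      ((continuous_bilinearComp_self _).continuousAt.comp e2)
  refine c1.congr ?_
  filter_upwards [(isOpen_extChartAt_source (I := I.prod I') s).mem_nhds
    (mem_extChartAt_source s)] with y hy
  refine ContinuousLinearMap.ext fun v => ContinuousLinearMap.ext fun w => ?_
  rw [bilinInChart_apply]
  rw [tangentCoordChange_prod I I' s y y hy (mem_extChartAt_source y)]
  rfl

end Prod

section Pi

variable {ι : Type*} [Fintype ι] {E : ι → Type*} [∀ i, NormedAddCommGroup (E i)]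
  [∀ i, NormedSpace ℝ (E i)] {H : ι → Type*} [∀ i, TopologicalSpace (H i)]
  (I : ∀ i, ModelWithCorners ℝ (E i) (H i))
  {M : ι → Type*} [∀ i, TopologicalSpace (M i)] [∀ i, ChartedSpace (H i) (M i)]
  [∀ i, IsManifold (I i) 1 (M i)]
  [h : ∀ i, RiemannianBundle (fun x : M i => TangentSpace (I i) x)]

set_option synthInstance.maxHeartbeats 200000 in
instance isContinuousRiemannianBundle_pi
    [hc : ∀ i, IsContinuousRiemannianBundle (E i) (fun x : M i => TangentSpace (I i) x)] :
    IsContinuousRiemannianBundle (∀ i, E i)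
      (fun x : ∀ i, M i => TangentSpace (ModelWithCorners.pi I) x) := by
  have hc := fun i => (isContinuousRiemannianBundle_iff (I i)).1 (hc i)
  rw [isContinuousRiemannianBundle_iff]
  intro s
  have e1 : ∀ i, ContinuousAt (fun y : ∀ i, M i => bilinInChart (I i) (h i).g.inner (s i) (y i)) s :=
    fun i => ContinuousAt.comp (g := bilinInChart (I i) (h i).g.inner (s i))
      (f := fun y : ∀ i, M i => y i) (hc i (s i)) (continuousAt_apply i s)
  have c1 : ContinuousAt (fun y : ∀ i, M i => ∑ i,
      (bilinInChart (I i) (h i).g.inner (s i) (y i)).bilinearComp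
        (ContinuousLinearMap.proj (R := ℝ) (φ := E) i)
        (ContinuousLinearMap.proj (R := ℝ) (φ := E) i)) s := by
    exact tendsto_finsetSum _ fun i _ =>
      (continuous_bilinearComp_self _).continuousAt.tendsto.comp (e1 i)
  refine c1.congr ?_
  filter_upwards [(isOpen_extChartAt_source (I := ModelWithCorners.pi I) s).mem_nhds
    (mem_extChartAt_source s)] with y hy
  refine ContinuousLinearMap.ext fun v => ContinuousLinearMap.ext fun w => ?_
  rw [bilinInChart_apply]
  refine Eq.trans ?_ (piInner_apply I y _ _).symm
  rw [sum_apply, sum_apply]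
  refine Finset.sum_congr rfl fun i _ => ?_
  have k : ∀ v : ∀ i, E i, piTangentProj I y i
      (tangentCoordChange (ModelWithCorners.pi I) s y y v) =
      (tangentCoordChange (I i) (s i) (y i) (y i) (v i) : E i) :=
    fun v => tangentCoordChange_pi I s y y hy (mem_extChartAt_source y) v i
  rw [k, k]
  rfl

end Pi

/-! ### Evaluation and update maps of a finite product -/

section PiMaps

variable {ι : Type*} [Fintype ι] {E : ι → Type*} [∀ i, NormedAddCommGroup (E i)]
  [∀ i, NormedSpace ℝ (E i)] {H : ι → Type*} [∀ i, TopologicalSpace (H i)]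
  (I : ∀ i, ModelWithCorners ℝ (E i) (H i))
  {M : ι → Type*} [∀ i, TopologicalSpace (M i)] [∀ i, ChartedSpace (H i) (M i)]
  {E' H' N : Type*} [NormedAddCommGroup E'] [NormedSpace ℝ E'] [TopologicalSpace H']
  {J : ModelWithCorners ℝ E' H'} [TopologicalSpace N] [ChartedSpace H' N]

theorem contMDiffAt_pi {n : ℕ∞ω} {f : N → ∀ i, M i} {x : N}
    (h : ∀ i, ContMDiffAt J (I i) n (fun y => f y i) x) :
    ContMDiffAt J (ModelWithCorners.pi I) n f x := by
  rw [contMDiffAt_iff]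
  refine ⟨continuousAt_pi.2 fun i => (h i).continuousAt, ?_⟩
  rw [contDiffWithinAt_pi]
  intro i
  rw [extChartAt_pi]
  exact (contMDiffAt_iff.1 (h i)).2

theorem hasMFDerivAt_pi {f : N → ∀ i, M i} {x : N} {f' : E' →L[ℝ] (∀ i, E i)}
    (h : ∀ i, HasMFDerivAt J (I i) (fun y => f y i) x
      ((ContinuousLinearMap.proj (R := ℝ) (φ := E) i) ∘L f' : E' →L[ℝ] E i)) :
    HasMFDerivAt J (ModelWithCorners.pi I) f x (f' : E' →L[ℝ] (∀ i, E i)) := by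
  refine ⟨continuousAt_pi.2 fun i => (h i).1, ?_⟩
  have key : HasFDerivWithinAt (fun v => fun i => writtenInExtChartAt J (I i) x (fun y => f y i) v)
      f' (range J) (extChartAt J x x) := hasFDerivWithinAt_pi'.2 fun i => (h i).2
  have e : writtenInExtChartAt J (ModelWithCorners.pi I) x f =
      fun v => fun i => writtenInExtChartAt J (I i) x (fun y => f y i) v := by
    unfold writtenInExtChartAt
    rw [extChartAt_pi]
    rfl
  exact e ▸ key

theorem contMDiff_eval (n : ℕ∞ω) [∀ i, IsManifold (I i) n (M i)] (i : ι) :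
    ContMDiff (ModelWithCorners.pi I) (I i) n (fun u : ∀ i, M i => u i) := by
  intro u
  rw [contMDiffAt_iff]
  refine ⟨continuousAt_apply i u, ?_⟩
  have h1 : ContDiffWithinAt ℝ n (fun v : ∀ i, E i => v i) (range (ModelWithCorners.pi I))
    (extChartAt (ModelWithCorners.pi I) u u) := 
    (ContinuousLinearMap.proj (R := ℝ) (φ := E) i).contDiff.contDiffWithinAt
  refine h1.congr_of_eventuallyEq_of_mem ?_ (mem_range_self _)
  filter_upwards [extChartAt_target_mem_nhdsWithin (I := ModelWithCorners.pi I) u] with v hv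
  rw [extChartAt_pi] at hv ⊢
  exact (extChartAt (I i) (u i)).right_inv (hv i trivial)

theorem hasMFDerivAt_eval (u : ∀ i, M i) (i : ι) :
    HasMFDerivAt (ModelWithCorners.pi I) (I i) (fun u : ∀ i, M i => u i) u
      (piTangentProj I u i) := by
  refine ⟨continuousAt_apply i u, ?_⟩
  have h1 : HasFDerivWithinAt (fun v : ∀ i, E i => v i)
    (ContinuousLinearMap.proj (R := ℝ) (φ := E) i) (range (ModelWithCorners.pi I))
    (extChartAt (ModelWithCorners.pi I) u u) :=
    (ContinuousLinearMap.proj (R := ℝ) (φ := E) i).hasFDerivWithinAt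
  have key : writtenInExtChartAt (ModelWithCorners.pi I) (I i) u (fun u : ∀ i, M i => u i)
      =ᶠ[𝓝[range (ModelWithCorners.pi I)] (extChartAt (ModelWithCorners.pi I) u u)]
      fun v => v i := by
    filter_upwards [extChartAt_target_mem_nhdsWithin (I := ModelWithCorners.pi I) u] with v hv
    simp only [writtenInExtChartAt, extChartAt_pi] at hv ⊢
    exact (extChartAt (I i) (u i)).right_inv (hv i trivial)
  exact HasFDerivWithinAt.congr_of_eventuallyEq h1 key
    (key.self_of_nhdsWithin (mem_range_self _))

variable [DecidableEq ι]

theorem contMDiff_update (n : ℕ∞ω) (u : ∀ i, M i) (i : ι) :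
    ContMDiff (I i) (ModelWithCorners.pi I) n (Function.update u i) := by
  intro c
  refine contMDiffAt_pi I fun j => ?_
  by_cases hj : j = i
  · subst hj
    simpa using! contMDiffAt_id
  · simp only [Function.update_of_ne hj]
    exact contMDiffAt_const

theorem hasMFDerivAt_update (u : ∀ i, M i) (i : ι) :
    HasMFDerivAt (I i) (ModelWithCorners.pi I) (Function.update u i) (u i)
      (ContinuousLinearMap.single ℝ E i : E i →L[ℝ] (∀ i, E i)) := by
  refine hasMFDerivAt_pi I fun j => ?_
  by_cases hj : j = i
  · subst hj
    have h : (ContinuousLinearMap.proj (R := ℝ) (φ := E) j) ∘L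
        (ContinuousLinearMap.single ℝ E j) = ContinuousLinearMap.id ℝ (E j) := by
      ext v; simp
    rw [h]
    exact (hasMFDerivAt_id (u j)).congr_of_eventuallyEq
      (Eventually.of_forall fun y => Function.update_self ..)
  · have h : (ContinuousLinearMap.proj (R := ℝ) (φ := E) j) ∘L
        (ContinuousLinearMap.single ℝ E i) = 0 := by
      ext v; simp [Pi.single_eq_of_ne hj]
    rw [h]
    exact (hasMFDerivAt_const (u j) (u i)).congr_of_eventuallyEq
      (Eventually.of_forall fun y => Function.update_of_ne hj ..)

end PiMaps

/-! ### Normal and Clarke tangent cones of a product set -/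

section NormalCones

variable {ι : Type*} [Fintype ι] [DecidableEq ι] {E : ι → Type*} [∀ i, NormedAddCommGroup (E i)]
  [∀ i, NormedSpace ℝ (E i)] {H : ι → Type*} [∀ i, TopologicalSpace (H i)]
  (I : ∀ i, ModelWithCorners ℝ (E i) (H i))
  {M : ι → Type*} [∀ i, TopologicalSpace (M i)] [∀ i, ChartedSpace (H i) (M i)]

/-- The inclusion of the `i`-th factor in the tangent space of a product. -/
def piTangentSingle (u : ∀ i, M i) (i : ι) :
    TangentSpace (I i) (u i) →L[ℝ] TangentSpace (ModelWithCorners.pi I) u :=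
  ContinuousLinearMap.single ℝ E i

theorem chi_eq_zero {X : Type*} {S : Set X} {x : X} (hx : x ∈ S) : chi S x = 0 := by
  simp [chi, hx]

theorem mem_of_chi_eq_coe {X : Type*} {S : Set X} {x : X} {r : ℝ} (hx : chi S x = r) : x ∈ S := by
  by_contra h
  simp [chi, h] at hx

/-- The test function is restricted to the slice through `u` in the `i`-th direction. The other
components of `u` stay in their sets, so the slice meets the product exactly in `S i`. -/
theorem frechetSubdiff_chi_pi {S : ∀ i, Set (M i)} {u : ∀ i, M i}
    {ξ : Cotangent (ModelWithCorners.pi I) u}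
    (hξ : ξ ∈ frechetSubdiff (ModelWithCorners.pi I) (chi {u | ∀ i, u i ∈ S i}) u) (i : ι) :
    ξ ∘L piTangentSingle I u i ∈ frechetSubdiff (I i) (chi (S i)) (u i) := by
  obtain ⟨⟨r, hr⟩, g, hg, hd, hm⟩ := hξ
  have hu : ∀ i, u i ∈ S i := mem_of_chi_eq_coe hr
  refine ⟨⟨0, chi_eq_zero (hu i)⟩, g ∘ Function.update u i,
    hg.comp (contMDiff_update I 1 u i), ?_, ?_⟩
  · have h1 : HasMFDerivAt (ModelWithCorners.pi I) 𝓘(ℝ, ℝ) g (Function.update u i (u i)) ξ := by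
      rw [Function.update_eq_self, ← hd]
      exact ((hg u).mdifferentiableAt one_ne_zero).hasMFDerivAt
    exact (h1.comp (u i) (hasMFDerivAt_update I u i)).mfderiv
  · have hc : ContinuousAt (Function.update u i) (u i) :=
      ((contMDiff_update I 0 u i) (u i)).continuousAt
    have hm' : IsLocalMin (fun x => chi {u | ∀ i, u i ∈ S i} x - (g x : EReal))
      (Function.update u i (u i)) := by rwa [Function.update_eq_self]
    have h := hm'.comp_continuous hc
    have e : (fun c => chi (S i) c - (((g ∘ Function.update u i) c : ℝ) : EReal)) =
        (fun x => chi {u | ∀ i, u i ∈ S i} x - (g x : EReal)) ∘ Function.update u i := by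
      funext c
      have : Function.update u i c ∈ {u | ∀ i, u i ∈ S i} ↔ c ∈ S i := by
        constructor
        · intro h; simpa using h i
        · intro hc j
          by_cases hj : j = i
          · subst hj; simpa using hc
          · simpa [hj] using hu j
      have h' : chi (S i) c = chi {u | ∀ i, u i ∈ S i} (Function.update u i c) :=
by
        unfold chi
        by_cases hcS : c ∈ S i
        · rw [if_pos hcS, if_pos (this.2 hcS)]
        · rw [if_neg hcS, if_neg (fun h => hcS (this.1 h))]
      simp only [h', Function.comp]
    rw [e]; exact h

variable [∀ i, IsManifold (I i) 1 (M i)]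

theorem tangentCoordChange_pi_single (x y z : ∀ i, M i)
    (hx : z ∈ (extChartAt (ModelWithCorners.pi I) x).source)
    (hy : z ∈ (extChartAt (ModelWithCorners.pi I) y).source) (i : ι) (v : E i) :
    tangentCoordChange (ModelWithCorners.pi I) x y z (Pi.single i v) =
      Pi.single i (tangentCoordChange (I i) (x i) (y i) (z i) v) := by
  funext j
  rw [tangentCoordChange_pi I x y z hx hy]
  by_cases hj : j = i
  · subst hj; simp
  · simp [hj]

theorem limitingNormalCone_pi {S : ∀ i, Set (M i)} {u : ∀ i, M i}
    {p : Cotangent (ModelWithCorners.pi I) u}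
    (hp : p ∈ limitingNormalCone (ModelWithCorners.pi I) {u | ∀ i, u i ∈ S i} u) (i : ι) :
    p ∘L piTangentSingle I u i ∈ limitingNormalCone (I i) (S i) (u i) := by
  obtain ⟨x, ξ, hξ, hx, hf, hc⟩ := hp
  have hxS : ∀ k, ∀ i, x k i ∈ S i := fun k => by
    obtain ⟨⟨r, hr⟩, -⟩ := hξ k
    exact mem_of_chi_eq_coe hr
  -- `chi` is zero at every `x k`, and its values converge to the value at `u`, which is therefore
  -- zero.
  have hu : ∀ i, u i ∈ S i := by
    refine mem_of_chi_eq_coe (r := 0) (tendsto_nhds_unique hf ?_)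
    simp only [chi_eq_zero (S := {u : ∀ i, M i | ∀ i, u i ∈ S i}) (hxS _)]
    exact tendsto_const_nhds
  refine ⟨fun k => x k i, fun k => ξ k ∘L piTangentSingle I (x k) i,
    fun k => frechetSubdiff_chi_pi I (hξ k) i, (tendsto_pi_nhds.1 hx) i, ?_, ?_⟩
  · simp only [chi_eq_zero (hu i), chi_eq_zero (hxS _ i)]
    exact tendsto_const_nhds
  · rw [tendstoCovector_iff] at hc ⊢
    refine ⟨(tendsto_pi_nhds.1 hx) i, ?_⟩
    have h2 := ((ContinuousLinearMap.precomp ℝ (ContinuousLinearMap.single ℝ E i)).continuous.tendsto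
      _).comp hc.2
    refine h2.congr' ?_
    filter_upwards [hx ((isOpen_extChartAt_source (I := ModelWithCorners.pi I) u).mem_nhds
      (mem_extChartAt_source u))] with k hk
    refine ContinuousLinearMap.ext fun v => ?_
    exact congrArg (show (∀ i, E i) →L[ℝ] ℝ from ξ k)
      (tangentCoordChange_pi_single I u (x k) (x k) hk (mem_extChartAt_source _) i v)

/-- Polarity reverses the inclusion of normal cones. This half of the product formula suffices,
because the multiplier conditions test one control at a time. -/
theorem single_mem_clarkeTangentCone {S : ∀ i, Set (M i)} {u : ∀ i, M i} {i : ι}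
    {v : TangentSpace (I i) (u i)} (hv : v ∈ clarkeTangentCone (I i) (S i) (u i)) :
    piTangentSingle I u i v ∈
      clarkeTangentCone (ModelWithCorners.pi I) {u | ∀ i, u i ∈ S i} u :=
  fun _ hp => hv _ (limitingNormalCone_pi I hp i)

end NormalCones

/-! ### From slow decrease to a touching function, in normed spaces -/

section Core

variable {V Y : Type*} [NormedAddCommGroup V] [NormedSpace ℝ V]
  [NormedAddCommGroup Y] [NormedSpace ℝ Y]

/-- On a compact set of directions, a lower bound for the increments of a Lipschitz function along
each direction is uniform. -/
theorem eventually_forall_increment_ge {f : Y → ℝ} {y₀ : Y} (A : V →L[ℝ] Y) {T : Set V}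
    (hT : IsCompact T) {K : NNReal} {s : Set Y} (hs : s ∈ 𝓝 y₀) (hf : LipschitzOnWith K f s)
    {Δ : ℝ}
    (hdec : ∀ v ∈ T, ∀ η > 0, ∀ᶠ t in 𝓝[>] (0 : ℝ),
      -(Δ * ‖v‖ + η) * t ≤ f (y₀ + t • A v) - f y₀) {η : ℝ} (hη : 0 < η) :
    ∀ᶠ t in 𝓝[>] (0 : ℝ), ∀ v ∈ T, -(Δ * ‖v‖ + η) * t ≤ f (y₀ + t • A v) - f y₀ := by
  -- The guard `0 < t` replaces the one-sided filter, so that compactness can be used with full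
  -- neighbourhoods of `(0, v)`.
  have key : ∀ᶠ t in 𝓝 (0 : ℝ), ∀ v ∈ T, 0 < t →
      -(Δ * ‖v‖ + η) * t ≤ f (y₀ + t • A v) - f y₀ := by
    refine hT.eventually_forall_of_forall_eventually (P := fun t v => 0 < t →
      -(Δ * ‖v‖ + η) * t ≤ f (y₀ + t • A v) - f y₀) fun v hv => ?_
    have h1 : ∀ᶠ z : ℝ × V in 𝓝 (0, v), 0 < z.1 →
        -(Δ * ‖v‖ + η / 2) * z.1 ≤ f (y₀ + z.1 • A v) - f y₀ := by
      have := hdec v hv (η / 2) (half_pos hη)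
      rw [eventually_nhdsWithin_iff] at this
      exact (continuous_fst.tendsto ((0 : ℝ), v)).eventually this
    have h2 : ∀ᶠ z : ℝ × V in 𝓝 (0, v), y₀ + z.1 • A v ∈ s := by
      have c : ContinuousAt (fun z : ℝ × V => y₀ + z.1 • A v) (0, v) := by fun_prop
      exact c (by simpa using hs)
    have h3 : ∀ᶠ z : ℝ × V in 𝓝 (0, v), y₀ + z.1 • A z.2 ∈ s := by
      have c : ContinuousAt (fun z : ℝ × V => y₀ + z.1 • A z.2) (0, v) := by fun_prop
      exact c (by simpa using hs)
    -- The cost of replacing the direction `v` by `z.2`: the first term comes from the Lipschitz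
    -- bound, the second from the change of `Δ * ‖v‖`.
    have h4 : ∀ᶠ z : ℝ × V in 𝓝 (0, v), K * ‖A v - A z.2‖ + Δ * (‖v‖ - ‖z.2‖) < η / 2 := by
      have c : ContinuousAt (fun z : ℝ × V => K * ‖A v - A z.2‖ + Δ * (‖v‖ - ‖z.2‖)) (0, v) := by
        fun_prop
      refine c.eventually (gt_mem_nhds ?_)
      simpa using hη
    filter_upwards [h1, h2, h3, h4] with z k1 k2 k3 k4 hz
    have k := hf.dist_le_mul _ k2 _ k3
    rw [Real.dist_eq, dist_eq_norm, add_sub_add_left_eq_sub, ← smul_sub, norm_smul,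
      Real.norm_of_nonneg hz.le] at k
    have k' := (abs_le.1 k).2
    have k5 := k1 hz
    have k6 := mul_le_mul_of_nonneg_right k4.le hz.le
    nlinarith
  rw [eventually_nhdsWithin_iff]
  filter_upwards [key] with t ht htp v hv
  exact ht v hv htp

variable [FiniteDimensional ℝ V] [FiniteDimensional ℝ Y]

set_option maxHeartbeats 1000000 in
/-- If a Lipschitz function does not decrease at a rate larger than `Δ` along the image of a closed
convex cone, then some nearby viscosity subgradient is almost nonnegative on this image. -/
theorem exists_subgradient_of_increment_ge {f : Y → ℝ} {y₀ : Y} (A : V →L[ℝ] Y) {T : Set V}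
    (hT : IsClosed T) (hT0 : (0 : V) ∈ T) (hTadd : ∀ v ∈ T, ∀ w ∈ T, v + w ∈ T)
    (hTsmul : ∀ v ∈ T, ∀ c : ℝ, 0 ≤ c → c • v ∈ T)
    {K : NNReal} {s : Set Y} (hs : s ∈ 𝓝 y₀) (hf : LipschitzOnWith K f s)
    {Δ : ℝ} (hΔ : 0 ≤ Δ)
    (hdec : ∀ v ∈ T, ∀ η > 0, ∀ᶠ t in 𝓝[>] (0 : ℝ),
      -(Δ * ‖v‖ + η) * t ≤ f (y₀ + t • A v) - f y₀)
    {δ : ℝ} (hδ : 0 < δ) {U : Set Y} (hU : U ∈ 𝓝 y₀) :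
    ∃ y ∈ U, ∃ h : Y → ℝ, ContDiff ℝ ∞ h ∧ IsLocalMin (fun x => f x - h x) y ∧
      ∀ w ∈ T, -((Δ + δ) * ‖w‖) ≤ fderiv ℝ h y (A w) := by
  -- The penalty below must be smooth, and the squared norm of `Y` need not be.
  let L : Y ≃L[ℝ] EuclideanSpace ℝ (Fin (Module.finrank ℝ Y)) := toEuclidean
  set C : ℝ := ‖(L.symm : EuclideanSpace ℝ (Fin (Module.finrank ℝ Y)) →L[ℝ] Y)‖ with hC
  have hC0 : 0 ≤ C := norm_nonneg _
  have hLC : ∀ z : Y, ‖z‖ ≤ C * ‖L z‖ := fun z => by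
    simpa using (L.symm : EuclideanSpace ℝ (Fin (Module.finrank ℝ Y)) →L[ℝ] Y).le_opNorm (L z)
  have hK0 : (0 : ℝ) ≤ K := K.2
  -- The summand `K * C ^ 2` keeps `‖z - A v‖ ≤ 1` at the minimizer, and `2 * (K * C) ^ 2 / δ` makes
  -- the maximum `(K * C) ^ 2 / (4 * κ)` of `K * C * r - κ * r ^ 2` at most `δ / 8`. The `1` ensures
  -- positivity.
  set κ : ℝ := 1 + K * C ^ 2 + 2 * (K * C) ^ 2 / δ with hκ
  have hκ0 : 0 < κ := by positivity
  have hκ1 : K * C ^ 2 ≤ κ := by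
    have : 0 ≤ 2 * (K * C) ^ 2 / δ := by positivity
    linarith
  have hκ2 : 2 * (K * C) ^ 2 ≤ δ * κ := by
    have : δ * (2 * (K * C) ^ 2 / δ) = 2 * (K * C) ^ 2 := by field_simp
    have : 0 ≤ δ * (1 + K * C ^ 2) := by positivity
    nlinarith
  set R : ℝ := ‖A‖ + 2 with hR
  have hTB : IsCompact (T ∩ Metric.closedBall 0 1) := (isCompact_closedBall 0 1).inter_left hT
  have e1 := eventually_forall_increment_ge A hTB hs hf (fun v hv => hdec v hv.1)
    (show 0 < δ / 8 by positivity)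
  have e2 : ∀ᶠ t in 𝓝[>] (0 : ℝ), ∀ z ∈ Metric.closedBall (0 : Y) R, y₀ + t • z ∈ s ∩ U := by
    have : ∀ᶠ t in 𝓝 (0 : ℝ), ∀ z ∈ Metric.closedBall (0 : Y) R, y₀ + t • z ∈ s ∩ U := by
      refine (isCompact_closedBall (0 : Y) R).eventually_forall_of_forall_eventually
        (P := fun t z => y₀ + t • z ∈ s ∩ U) fun z _ => ?_
      have c : ContinuousAt (fun z : ℝ × Y => y₀ + z.1 • z.2) (0, z) := by fun_prop
      exact c (by simpa using inter_mem hs hU)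
    exact nhdsWithin_le_nhds this
  obtain ⟨t, ⟨ht1, ht2⟩, ht⟩ := ((e1.and e2).and self_mem_nhdsWithin).exists
  have ht : 0 < t := ht
  have hlip : ∀ z ∈ Metric.closedBall (0 : Y) R, ∀ z' ∈ Metric.closedBall (0 : Y) R,
      f (y₀ + t • z) - f (y₀ + t • z') ≤ t * (K * ‖z - z'‖) := by
    intro z hz z' hz'
    have k := hf.dist_le_mul _ (ht2 z hz).1 _ (ht2 z' hz').1
    rw [Real.dist_eq, dist_eq_norm, add_sub_add_left_eq_sub, ← smul_sub, norm_smul,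
      Real.norm_of_nonneg ht.le] at k
    linarith [(abs_le.1 k).2]
  -- Direction and displacement are decoupled: the constraint `x.2 = A x.1` is relaxed to a
  -- quadratic penalty. The term `δ / 2 * ‖x.1‖ ^ 2` keeps the minimizing direction inside the unit
  -- ball.
  let g : V × Y → ℝ := fun x => f (y₀ + t • x.2) +
    t * (Δ * ‖x.1‖ + δ / 2 * ‖x.1‖ ^ 2 + κ * ‖L (x.2 - A x.1)‖ ^ 2)
  have hg : ContinuousOn g ((T ∩ Metric.closedBall 0 1) ×ˢ Metric.closedBall 0 R) := by
    refine ContinuousOn.add ?_ (by fun_prop)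
    refine hf.continuousOn.comp (by fun_prop) fun x hx => (ht2 _ hx.2).1
  have hR0 : (0 : Y) ∈ Metric.closedBall (0 : Y) R := by
    simp only [Metric.mem_closedBall, dist_self]; positivity
  obtain ⟨⟨v, z⟩, ⟨⟨hvT, hvB⟩, hz⟩, hmin⟩ := (hTB.prod (isCompact_closedBall (0 : Y) R)).exists_isMinOn
    ⟨(0, 0), ⟨hT0, by simp⟩, hR0⟩ hg
  have hmin' : ∀ v' ∈ T, ‖v'‖ ≤ 1 → ∀ z' : Y, ‖z'‖ ≤ R → g (v, z) ≤ g (v', z') :=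
    fun v' h1 h2 z' h3 => hmin (show (v', z') ∈ _ from
      ⟨⟨h1, by simpa using h2⟩, by simpa using h3⟩)
  have hv1 : ‖v‖ ≤ 1 := by simpa using hvB
  have hAv : ‖A v‖ ≤ ‖A‖ := (A.le_opNorm v).trans (mul_le_of_le_one_right (norm_nonneg _) hv1)
  have hAvR : ‖A v‖ ≤ R := by linarith
  set d := z - A v with hd
  -- Comparison of the minimizer `(v, z)` with `(v, A v)`.
  have c1 : κ * ‖L d‖ ^ 2 ≤ K * ‖d‖ := by
    have h := hmin' v hvT hv1 (A v) hAvR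
    have h' := hlip (A v) (by simpa using hAvR) z hz
    rw [norm_sub_rev, ← hd] at h'
    simp only [g, ← hd, sub_self, map_zero, norm_zero] at h
    have : t * (κ * ‖L d‖ ^ 2) ≤ t * (K * ‖d‖) := by linarith
    exact le_of_mul_le_mul_left this ht
  have hLd := hLC d
  have hd1 : ‖d‖ ≤ 1 := by
    by_contra! hcon
    have a1 : K * C ^ 2 * ‖d‖ ≤ κ * ‖d‖ :=
      mul_le_mul_of_nonneg_right hκ1 (norm_nonneg d)
    have a2 : κ * ‖d‖ ^ 2 ≤ κ * ‖d‖ := by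
      calc κ * ‖d‖ ^ 2 ≤ κ * (C * ‖L d‖) ^ 2 := by gcongr
        _ = C ^ 2 * (κ * ‖L d‖ ^ 2) := by ring
        _ ≤ C ^ 2 * (K * ‖d‖) := by gcongr
        _ ≤ κ * ‖d‖ := by linarith
    have a3 : ‖d‖ ^ 2 ≤ ‖d‖ := le_of_mul_le_mul_left a2 hκ0
    nlinarith
  have hzR : ‖z‖ < R := by
    have : z = d + A v := by simp [hd]
    rw [this]
    linarith [norm_add_le d (A v)]
  -- Comparison with `(0, 0)` gives `‖v‖ ^ 2 ≤ 1 / 2`: one `δ / 8` is the error in the uniform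
  -- increment bound, the other comes from the choice of `κ`.
  have hv : ‖v‖ < 1 := by
    have h := hmin' 0 hT0 (by simp) 0 (by simpa using hR0)
    simp only [g, ← hd, map_zero, norm_zero, smul_zero, add_zero, sub_zero] at h
    have h' := hlip (A v) (by simpa using hAvR) z hz
    rw [norm_sub_rev, ← hd] at h'
    have h'' := ht1 v ⟨hvT, hvB⟩
    have b1 : t * (δ / 2 * ‖v‖ ^ 2) ≤ t * (δ / 8 + K * ‖d‖ - κ * ‖L d‖ ^ 2) := by linarith
    have b2 := le_of_mul_le_mul_left b1 ht
    have b3 : K * ‖d‖ ≤ K * C * ‖L d‖ := by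
      rw [mul_assoc]; exact mul_le_mul_of_nonneg_left hLd hK0
    have b4 : K * C * ‖L d‖ - κ * ‖L d‖ ^ 2 ≤ δ / 8 := by
      have h0 : 4 * κ * (K * C * ‖L d‖ - κ * ‖L d‖ ^ 2) =
          (K * C) ^ 2 - (K * C - 2 * κ * ‖L d‖) ^ 2 := by ring
      have : 4 * κ * (K * C * ‖L d‖ - κ * ‖L d‖ ^ 2) ≤ 4 * κ * (δ / 8) := by
        linarith [sq_nonneg (K * C - 2 * κ * ‖L d‖)]
      exact le_of_mul_le_mul_left this (by positivity)
    have b5 : δ / 2 * ‖v‖ ^ 2 ≤ δ / 2 * (1 / 2) := by linarith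
    have b6 := le_of_mul_le_mul_left b5 (by positivity)
    by_contra! hcon
    nlinarith
  let a : Y → EuclideanSpace ℝ (Fin (Module.finrank ℝ Y)) := fun y => L (t⁻¹ • (y - y₀) - A v)
  have ha : ∀ z', a (y₀ + t • z') = L (z' - A v) := fun z' => by
    simp [a, smul_smul, ht.ne']
  -- Minimality in `z` with `v` frozen says that `f` plus the coupling penalty has a local minimum,
  -- so the touching function is minus that penalty.
  refine ⟨y₀ + t • z, (ht2 z hz).2, fun y => -(t * κ) * ‖a y‖ ^ 2, ?_, ?_, ?_⟩
  · refine contDiff_const.mul (ContDiff.norm_sq ℝ ?_)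
    exact L.contDiff.comp (by fun_prop)
  · have c : ContinuousAt (fun y => t⁻¹ • (y - y₀)) (y₀ + t • z) := by fun_prop
    have : ∀ᶠ y in 𝓝 (y₀ + t • z), t⁻¹ • (y - y₀) ∈ Metric.ball (0 : Y) R := by
      refine c (Metric.isOpen_ball.mem_nhds ?_)
      simpa [smul_smul, ht.ne'] using hzR
    filter_upwards [this] with y hy
    have hyz : y = y₀ + t • (t⁻¹ • (y - y₀)) := by simp [smul_smul, ht.ne']
    set z' := t⁻¹ • (y - y₀)
    rw [hyz, ha, ha]
    have h := hmin' v hvT hv1 z' (by simpa using (Metric.mem_ball.1 hy).le)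
    simp only [g, ← hd] at h ⊢
    linarith
  · intro w hw
    have hfd : HasFDerivAt (fun y => -(t * κ) * ‖a y‖ ^ 2)
        ((-(t * κ)) • (2 • (innerSL ℝ (a (y₀ + t • z))).comp
          ((L : Y →L[ℝ] _) ∘L (t⁻¹ • ContinuousLinearMap.id ℝ Y)))) (y₀ + t • z) := by
      refine HasFDerivAt.const_mul (HasFDerivAt.norm_sq ?_) _
      refine L.toContinuousLinearMap.hasFDerivAt.comp _ ?_
      exact (((hasFDerivAt_id _).sub_const y₀).const_smul t⁻¹).sub_const (A v)
    rw [hfd.fderiv, ha, ← hd]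
    have hval : ((-(t * κ)) • (2 • (innerSL ℝ (L d)).comp
          ((L : Y →L[ℝ] _) ∘L (t⁻¹ • ContinuousLinearMap.id ℝ Y)))) (A w) =
        -(2 * κ * inner ℝ (L d) (L (A w))) := by
      simp
      field_simp
    rw [hval]
    set B : ℝ := δ / 2 * ‖w‖ ^ 2 + κ * ‖L (A w)‖ ^ 2 with hB
    -- Minimality in the direction, with `z` frozen: `v + r • w` stays in the convex cone and in the
    -- unit ball. As `‖v‖ ≤ 1`, the quadratic term contributes at most `δ * ‖w‖` to first order in
    -- `r`.
    have hev : ∀ᶠ r in 𝓝[>] (0 : ℝ),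
        0 ≤ (Δ + δ) * ‖w‖ - 2 * κ * inner ℝ (L d) (L (A w)) + r * B := by
      have c : ContinuousAt (fun r : ℝ => ‖v + r • w‖) 0 := by fun_prop
      have hr1 : ∀ᶠ r in 𝓝[>] (0 : ℝ), ‖v + r • w‖ < 1 :=
        nhdsWithin_le_nhds (c.eventually (gt_mem_nhds (by simpa using hv)))
      filter_upwards [hr1, self_mem_nhdsWithin] with r hr1 hr
      have hr : 0 < r := hr
      have h := hmin' (v + r • w) (hTadd _ hvT _ (hTsmul _ hw r hr.le)) hr1.le z hzR.le
      have hdw : z - A (v + r • w) = d - r • A w := by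
        rw [hd, map_add, map_smul]; abel
      simp only [g, ← hd, hdw] at h
      have hn : ‖v + r • w‖ ≤ ‖v‖ + r * ‖w‖ := by
        refine (norm_add_le _ _).trans_eq ?_
        rw [norm_smul, Real.norm_of_nonneg hr.le]
      have hn2 : ‖v + r • w‖ ^ 2 ≤ ‖v‖ ^ 2 + 2 * r * ‖w‖ + r ^ 2 * ‖w‖ ^ 2 := by
        calc ‖v + r • w‖ ^ 2 ≤ (‖v‖ + r * ‖w‖) ^ 2 := by gcongr
          _ = ‖v‖ ^ 2 + 2 * r * ‖w‖ * ‖v‖ + r ^ 2 * ‖w‖ ^ 2 := by ring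
          _ ≤ ‖v‖ ^ 2 + 2 * r * ‖w‖ + r ^ 2 * ‖w‖ ^ 2 := by
            have : 2 * r * ‖w‖ * ‖v‖ ≤ 2 * r * ‖w‖ := mul_le_of_le_one_right (by positivity) hv1
            linarith
      have hq : ‖L (d - r • A w)‖ ^ 2 =
          ‖L d‖ ^ 2 - 2 * r * inner ℝ (L d) (L (A w)) + r ^ 2 * ‖L (A w)‖ ^ 2 := by
        rw [map_sub, map_smul, norm_sub_sq_real, inner_smul_right, norm_smul,
          Real.norm_of_nonneg hr.le]
        ring
      rw [hq] at h
      have h1 : t * 0 ≤ t * (Δ * (r * ‖w‖) + δ / 2 * (2 * r * ‖w‖ + r ^ 2 * ‖w‖ ^ 2) +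
          κ * (-(2 * r * inner ℝ (L d) (L (A w))) + r ^ 2 * ‖L (A w)‖ ^ 2)) := by
        have i1 := mul_le_mul_of_nonneg_left hn (mul_nonneg ht.le hΔ)
        have i2 := mul_le_mul_of_nonneg_left hn2 (mul_nonneg ht.le (half_pos hδ).le)
        linarith
      have h2 := le_of_mul_le_mul_left h1 ht
      have h3 : r * 0 ≤ r * ((Δ + δ) * ‖w‖ - 2 * κ * inner ℝ (L d) (L (A w)) + r * B) := by
        rw [hB]; linarith
      exact le_of_mul_le_mul_left h3 hr
    have hlim : Tendsto (fun r : ℝ => (Δ + δ) * ‖w‖ - 2 * κ * inner ℝ (L d) (L (A w)) + r * B)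
        (𝓝[>] 0) (𝓝 ((Δ + δ) * ‖w‖ - 2 * κ * inner ℝ (L d) (L (A w)) + 0 * B)) :=
      tendsto_nhdsWithin_of_tendsto_nhds (Continuous.tendsto (by fun_prop) 0)
    have := ge_of_tendsto hlim hev
    linarith

end Core

/-! ### `φ`-regularity tested by smooth functions in a chart -/

section Pieces

variable {E H M : Type*} [NormedAddCommGroup E] [NormedSpace ℝ E] [TopologicalSpace H]
  (I : ModelWithCorners ℝ E H) [TopologicalSpace M] [ChartedSpace H M]

theorem frechetSubdiff_subset_limitingSubdiffReal [IsManifold I 1 M] (f : M → ℝ) (q : M) :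
    frechetSubdiff I (fun x => (f x : EReal)) q ⊆ limitingSubdiffReal I f q := fun p hp =>
  ⟨fun _ => q, fun _ => p, fun _ => hp, tendsto_const_nhds, tendsto_const_nhds, by
    unfold TendstoCovector; exact tendsto_const_nhds⟩

/-- The differential at `x` of the preferred chart at `s`. -/
def chartDiff [IsManifold I 1 M] (s x : M) : TangentSpace I x →L[ℝ] E :=
  (trivializationAt E (TangentSpace I) s).continuousLinearMapAt ℝ x

theorem chartDiff_apply [IsManifold I 1 M] {s x : M} (hx : x ∈ (chartAt H s).source)
    (v : TangentSpace I x) : chartDiff I s x v = tangentCoordChange I x s x v :=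
  congrArg (fun f : TangentSpace I x →L[ℝ] E => f v)
    (TangentBundle.continuousLinearMapAt_trivializationAt_eq_core hx)

theorem chartDiff_eq_mfderiv [IsManifold I 1 M] {s x : M} (hx : x ∈ (chartAt H s).source) :
    chartDiff I s x = mfderiv I 𝓘(ℝ, E) (extChartAt I s) x :=
  TangentBundle.continuousLinearMapAt_trivializationAt hx

variable [FiniteDimensional ℝ E] [T2Space M] [IsManifold I ∞ M]

theorem frechetSubdiff_of_isLocalMin_chart (s : M) (f : M → ℝ) {h : E → ℝ}
    (hh : ContDiff ℝ ∞ h) {y : E} (hy : y ∈ (extChartAt I s).target)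
    (hm : IsLocalMin (fun z => f ((extChartAt I s).symm z) - h z) y) :
    (fderiv ℝ h y) ∘L chartDiff I s ((extChartAt I s).symm y) ∈
      frechetSubdiff I (fun x => (f x : EReal)) ((extChartAt I s).symm y) := by
  set x := (extChartAt I s).symm y with hx
  have hxs : x ∈ (extChartAt I s).source := (extChartAt I s).map_target hy
  have hxc : x ∈ (chartAt H s).source := by rwa [extChartAt_source] at hxs
  have hxy : extChartAt I s x = y := (extChartAt I s).right_inv hy
  -- A Fréchet subgradient requires a function on all of `M`; a bump function supported in the chart
  -- domain extends `h` without changing it near `x`.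
  obtain ⟨b, hb⟩ := ((SmoothBumpFunction.nhds_basis_tsupport (I := I) x).mem_iff).1
    ((isOpen_extChartAt_source (I := I) s).mem_nhds hxs)
  let g : M → ℝ := fun z => b z * h (extChartAt I s z)
  have hge : g =ᶠ[𝓝 x] h ∘ extChartAt I s := by
    filter_upwards [b.eventuallyEq_one] with z hz
    simp [g, hz]
  refine ⟨⟨f x, rfl⟩, g, ?_, ?_, ?_⟩
  · refine contMDiff_of_tsupport fun z hz => ?_
    have hz' : z ∈ (chartAt H s).source := by
      have : tsupport g ⊆ tsupport b := closure_mono (fun w hw hbw => hw (by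
        simp only [g, hbw, zero_mul]))
      have := hb.2 (this hz)
      rwa [extChartAt_source] at this
    have k1 : ContMDiffAt I 𝓘(ℝ, ℝ) 1 b z := b.contMDiffAt.of_le (by simp)
    have k2 : ContMDiffAt I 𝓘(ℝ, ℝ) 1 (h ∘ extChartAt I s) z :=
      ((hh.of_le (by simp)).contMDiff.contMDiffAt).comp z
        (contMDiffAt_extChartAt' (n := 1) hz')
    exact k1.mul k2
  · rw [hge.mfderiv_eq]
    have k1 : HasMFDerivAt I 𝓘(ℝ, E) (extChartAt I s) x (chartDiff I s x) := by
      rw [chartDiff_eq_mfderiv I hxc]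
      exact (mdifferentiableAt_extChartAt hxc).hasMFDerivAt
    have k2 : HasMFDerivAt 𝓘(ℝ, E) 𝓘(ℝ, ℝ) h (extChartAt I s x) (fderiv ℝ h y) := by
      rw [hxy]
      exact ((hh.differentiable (by simp)) y).hasFDerivAt.hasMFDerivAt
    exact (k2.comp x k1).mfderiv
  · have hc : ContinuousAt (extChartAt I s) x := continuousAt_extChartAt' hxs
    have h1 : ∀ᶠ z in 𝓝 x, f x - h y ≤ f ((extChartAt I s).symm (extChartAt I s z)) -
        h (extChartAt I s z) := by
      have hm' : IsLocalMin (fun z => f ((extChartAt I s).symm z) - h z) (extChartAt I s x) := by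
        rwa [hxy]
      have := hc.eventually hm'
      simpa only [hxy] using this
    filter_upwards [h1, hge, (isOpen_extChartAt_source (I := I) s).mem_nhds hxs] with z z1 z2 z3
    rw [(extChartAt I s).left_inv z3] at z1
    rw [hge.self_of_nhds, z2]
    simp only [Function.comp, hxy, ← EReal.coe_sub, EReal.coe_le_coe_iff]
    exact z1

variable {P : Type*} [PseudoMetricSpace P]
  [RiemannianBundle (fun x : M => TangentSpace I x)]

/-- All covectors are read in the one chart at `s`, in which the subgradient is exactly the
derivative of the test function: the chart differential cancels the coordinate change. -/
theorem IsPhiRegular.exists_subseq_chart {φ : P → M → ℝ} {e₀ : P} {s : M}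
    (hφ : IsPhiRegular I φ e₀ s) {e : ℕ → P} (he : Tendsto e atTop (𝓝 e₀)) {y : ℕ → E}
    (hy : Tendsto y atTop (𝓝 (extChartAt I s s))) (hyt : ∀ k, y k ∈ (extChartAt I s).target)
    {h : ℕ → E → ℝ} (hh : ∀ k, ContDiff ℝ ∞ (h k))
    (hm : ∀ k, IsLocalMin (fun z => φ (e k) ((extChartAt I s).symm z) - h k z) (y k)) :
    ∃ σ : ℕ → ℕ, StrictMono σ ∧ ∃ p ∈ limitingSubdiffReal I (φ e₀) s,
      Tendsto (fun k => fderiv ℝ (h (σ k)) (y (σ k))) atTop (𝓝 (show E →L[ℝ] ℝ from p)) := by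
  have hx : Tendsto (fun k => (extChartAt I s).symm (y k)) atTop (𝓝 s) := by
    have := (continuousAt_extChartAt_symm (I := I) s).tendsto.comp hy
    rwa [extChartAt_to_inv] at this
  obtain ⟨σ, hσ, p, hp, hc⟩ := hφ.exists_subseq e _ _ he hx fun k =>
    frechetSubdiff_subset_limitingSubdiffReal I _ _
      (frechetSubdiff_of_isLocalMin_chart I s (φ (e k)) (hh k) (hyt k) (hm k))
  refine ⟨σ, hσ, p, hp, ?_⟩
  rw [tendstoCovector_iff] at hc
  refine hc.2.congr fun k => ?_
  set x := (extChartAt I s).symm (y (σ k))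
  have hxs : x ∈ (extChartAt I s).source := (extChartAt I s).map_target (hyt _)
  refine ContinuousLinearMap.ext fun v => ?_
  refine congrArg (fderiv ℝ (h (σ k)) (y (σ k))) ?_
  refine (chartDiff_apply I (by rwa [extChartAt_source] at hxs) _).trans ?_
  exact (tangentCoordChange_comp ⟨⟨hxs, mem_extChartAt_source x⟩, hxs⟩).trans
    (tangentCoordChange_self hxs)

/-- By continuity of the metric, the chart differential has operator norm below some `C` near `s`. A
coordinate derivative smaller than `Δ / C` therefore gives a subgradient of dual norm less than `Δ`,
which is excluded where `φ` is positive. -/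
theorem IsPhiRegular.eventually_eq_zero_of_tendsto
    [IsContinuousRiemannianBundle E (fun x : M => TangentSpace I x)]
    {φ : P → M → ℝ} (hφ0 : ∀ e x, 0 ≤ φ e x) {e₀ : P} {s : M}
    (hφ : IsPhiRegular I φ e₀ s) {e : ℕ → P} (he : Tendsto e atTop (𝓝 e₀)) {y : ℕ → E}
    (hy : Tendsto y atTop (𝓝 (extChartAt I s s))) (hyt : ∀ k, y k ∈ (extChartAt I s).target)
    {h : ℕ → E → ℝ} (hh : ∀ k, ContDiff ℝ ∞ (h k))
    (hm : ∀ k, IsLocalMin (fun z => φ (e k) ((extChartAt I s).symm z) - h k z) (y k))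
    (h0 : Tendsto (fun k => fderiv ℝ (h k) (y k)) atTop (𝓝 0)) :
    ∀ᶠ k in atTop, φ (e k) ((extChartAt I s).symm (y k)) = 0 := by
  have hx : Tendsto (fun k => (extChartAt I s).symm (y k)) atTop (𝓝 s) := by
    have := (continuousAt_extChartAt_symm (I := I) s).tendsto.comp hy
    rwa [extChartAt_to_inv] at this
  obtain ⟨ε, hε, Δ, hΔ, hn⟩ := hφ.norm_ge
  obtain ⟨C, hC, hCn⟩ := eventually_norm_trivializationAt_lt E (fun x : M => TangentSpace I x) s
  have a1 : ∀ᶠ k in atTop, edist (e k) e₀ < ENNReal.ofReal (ε / 2) :=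
    he (Metric.eball_mem_nhds _ (by simpa using hε))
  have a2 := hx.eventually (eventually_riemannianEDist_lt I s
    (c := ENNReal.ofReal (ε / 2)) (by simpa using hε))
  have a3 : ∀ᶠ k in atTop, ‖fderiv ℝ (h k) (y k)‖ < Δ / C :=
    (tendsto_norm_zero.comp h0).eventually (gt_mem_nhds (by positivity))
  filter_upwards [a1, a2, a3, hx.eventually hCn] with k k1 k2 k3 k4
  by_contra hne
  have hpos := lt_of_le_of_ne (hφ0 (e k) ((extChartAt I s).symm (y k))) (Ne.symm hne)
  have hd : edist (e k) e₀ + Manifold.riemannianEDist I ((extChartAt I s).symm (y k)) s <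
      ENNReal.ofReal ε := by
    rw [Manifold.riemannianEDist_comm, ← add_halves ε,
      ENNReal.ofReal_add (by positivity) (by positivity)]
    exact ENNReal.add_lt_add k1 k2
  have hge := hn (e k) _ hd hpos _ (frechetSubdiff_subset_limitingSubdiffReal I _ _
      (frechetSubdiff_of_isLocalMin_chart I s (φ (e k)) (hh k) (hyt k) (hm k)))
  have hle := ContinuousLinearMap.opNorm_comp_le (fderiv ℝ (h k) (y k))
    (chartDiff I s ((extChartAt I s).symm (y k)))
  have : ‖fderiv ℝ (h k) (y k)‖ * ‖chartDiff I s ((extChartAt I s).symm (y k))‖ < Δ := by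
    calc _ ≤ ‖fderiv ℝ (h k) (y k)‖ * C :=
          mul_le_mul_of_nonneg_left k4.le (norm_nonneg _)
      _ < Δ / C * C := by gcongr
      _ = Δ := by field_simp
  linarith

end Pieces

/-! ### Common subsequences, increments along curves, slices -/

theorem exists_common_subseq {ι : Type*} [Finite ι] (R : ι → (ℕ → ℕ) → Prop)
    (mono : ∀ i σ τ, R i σ → StrictMono τ → R i (σ ∘ τ))
    (ex : ∀ i σ, StrictMono σ → ∃ τ : ℕ → ℕ, StrictMono τ ∧ R i (σ ∘ τ)) {σ₀ : ℕ → ℕ}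
    (hσ₀ : StrictMono σ₀) : ∃ τ : ℕ → ℕ, StrictMono τ ∧ ∀ i, R i (σ₀ ∘ τ) := by
  classical
  cases nonempty_fintype ι
  suffices h : ∀ s : Finset ι, ∃ τ : ℕ → ℕ, StrictMono τ ∧ ∀ i ∈ s, R i (σ₀ ∘ τ) by
    simpa using h Finset.univ
  intro s
  induction s using Finset.induction_on with
  | empty => exact ⟨id, strictMono_id, by simp⟩
  | insert a s _ ih =>
    obtain ⟨τ, hτ, h⟩ := ih
    obtain ⟨τ', hτ', h'⟩ := ex a (σ₀ ∘ τ) (hσ₀.comp hτ)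
    refine ⟨τ ∘ τ', hτ.comp hτ', fun i hi => ?_⟩
    rcases Finset.mem_insert.1 hi with rfl | hi
    · exact h'
    · exact mono i (σ₀ ∘ τ) τ' (h i hi) hτ'

/-- A curve and its tangent line differ by `o(t)`, which a Lipschitz function does not see to first
order. -/
theorem increment_ge_of_curve {Y : Type*} [NormedAddCommGroup Y] [NormedSpace ℝ Y] {f : Y → ℝ}
    {K : NNReal} {c : ℝ → Y} {w : Y} {s : Set Y} (hs : s ∈ 𝓝 (c 0)) (hf : LipschitzOnWith K f s)
    (hc : HasDerivAt c w 0) {a : ℝ} (hev : ∀ᶠ t in 𝓝[>] (0 : ℝ), a < (f (c t) - f (c 0)) / t)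
    {η : ℝ} (hη : 0 < η) :
    ∀ᶠ t in 𝓝[>] (0 : ℝ), (a - η) * t ≤ f (c 0 + t • w) - f (c 0) := by
  have h1 : ∀ᶠ t in 𝓝 (0 : ℝ), c t ∈ s := hc.continuousAt hs
  have h2 : ∀ᶠ t in 𝓝 (0 : ℝ), c 0 + t • w ∈ s := by
    have : ContinuousAt (fun t : ℝ => c 0 + t • w) 0 := by fun_prop
    exact this (by simpa using hs)
  -- `K + 1` instead of `K` covers the case `K = 0`.
  have h3 := (hasDerivAt_iff_isLittleO.1 hc).def (show 0 < η / (K + 1) by positivity)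
  filter_upwards [hev, nhdsWithin_le_nhds h1, nhdsWithin_le_nhds h2, nhdsWithin_le_nhds h3,
    self_mem_nhdsWithin] with t k0 k1 k2 k3 ht
  have ht : 0 < t := ht
  rw [lt_div_iff₀ ht] at k0
  simp only [sub_zero, Real.norm_of_nonneg ht.le] at k3
  have k4 := hf.dist_le_mul _ k1 _ k2
  rw [Real.dist_eq, dist_eq_norm, ← sub_sub] at k4
  have k5 := (abs_le.1 k4).2
  have k6 : K * ‖c t - c 0 - t • w‖ ≤ η * t := by
    calc K * ‖c t - c 0 - t • w‖ ≤ (K + 1) * (η / (K + 1) * t) := by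
          gcongr; linarith
      _ = η * t := by field_simp
  linarith

/-- Restricting a local minimum to an affine subspace. -/
theorem isLocalMin_slice {Y Z : Type*} [NormedAddCommGroup Y] [NormedSpace ℝ Y]
    [NormedAddCommGroup Z] [NormedSpace ℝ Z] {f h : Y → ℝ} {y : Y} (hh : ContDiff ℝ ∞ h)
    (hm : IsLocalMin (fun x => f x - h x) y) (L : Z →L[ℝ] Y) (z₀ : Z) {φ : Z → ℝ} {r : ℝ}
    (hφ : ∀ z, f (y + L (z - z₀)) = φ z + r) :
    ContDiff ℝ ∞ (fun z => h (y + L (z - z₀))) ∧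
      IsLocalMin (fun z => φ z - h (y + L (z - z₀))) z₀ ∧
      fderiv ℝ (fun z => h (y + L (z - z₀))) z₀ = (fderiv ℝ h y) ∘L L := by
  have hy : y + L (z₀ - z₀) = y := by simp
  refine ⟨hh.comp (by fun_prop), ?_, ?_⟩
  · have hm' : IsLocalMin (fun x => f x - h x) (y + L (z₀ - z₀)) := by rwa [hy]
    have hc : ContinuousAt (fun z => y + L (z - z₀)) z₀ := by fun_prop
    filter_upwards [hc.eventually hm'] with z hz
    rw [hφ, hφ] at hz
    linarith
  · have h1 : HasFDerivAt (fun z => y + L (z - z₀)) L z₀ := by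
      have := (L.hasFDerivAt.comp z₀ ((hasFDerivAt_id z₀).sub_const z₀)).const_add y
      simpa using this
    have h2 : HasFDerivAt h (fderiv ℝ h y) (y + L (z₀ - z₀)) := by
      rw [hy]; exact ((hh.differentiable (by simp)) y).hasFDerivAt
    exact (h2.comp z₀ h1).fderiv

/-! ### Curves and tangent maps seen in charts -/

section Curves

variable {E H M : Type*} [NormedAddCommGroup E] [NormedSpace ℝ E] [TopologicalSpace H]
  (I : ModelWithCorners ℝ E H) [TopologicalSpace M] [ChartedSpace H M] [IsManifold I 1 M]
  {E' H' N : Type*} [NormedAddCommGroup E'] [NormedSpace ℝ E'] [TopologicalSpace H']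
  (J : ModelWithCorners ℝ E' H') [TopologicalSpace N] [ChartedSpace H' N]

theorem hasDerivAt_chart_comp_curve {g : N → M} (hg : ContMDiff J I 1 g) {u : N} {s : M}
    (hu : g u ∈ (chartAt H s).source) {c : ℝ → N} {v : TangentSpace J u}
    (hc : IsSmoothCurveWithVelocity J c u v) :
    HasDerivAt (fun t => extChartAt I s (g (c t))) (chartDiff I s (g u) (mfderiv J I g u v)) 0 := by
  obtain ⟨hc1, rfl, hc2⟩ := hc
  have k1 : HasMFDerivAt 𝓘(ℝ, ℝ) J c 0 (mfderiv 𝓘(ℝ, ℝ) J c 0) :=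
    ((hc1 0).mdifferentiableAt (by simp)).hasMFDerivAt
  have k2 : HasMFDerivAt J I g (c 0) (mfderiv J I g (c 0)) :=
    ((hg (c 0)).mdifferentiableAt (by simp)).hasMFDerivAt
  have k3 : HasMFDerivAt I 𝓘(ℝ, E) (extChartAt I s) (g (c 0)) (chartDiff I s (g (c 0))) := by
    rw [chartDiff_eq_mfderiv I hu]
    exact (mdifferentiableAt_extChartAt hu).hasMFDerivAt
  let L : TangentSpace 𝓘(ℝ, ℝ) (0 : ℝ) →L[ℝ] E :=
    (chartDiff I s (g (c 0)) ∘L mfderiv J I g (c 0)) ∘L mfderiv 𝓘(ℝ, ℝ) J c 0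
  have k4 : HasFDerivAt (fun t => extChartAt I s (g (c t))) (show ℝ →L[ℝ] E from L) 0 :=
    ((k3.comp (c 0) k2).comp (0 : ℝ) k1).hasFDerivAt
  refine k4.hasDerivAt.congr_deriv ?_
  rw [← hc2]
  rfl

theorem tendsto_chartDiff_mfderiv [IsManifold J 1 N] {g : N → M} (hg : ContMDiff J I 1 g)
    {α : Type*} {l : Filter α}
    {x : α → N} {w : ∀ k, TangentSpace J (x k)} {u : N} {v : TangentSpace J u}
    (h : Tendsto (fun k => (⟨x k, w k⟩ : TangentBundle J N)) l (𝓝 ⟨u, v⟩)) :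
    Tendsto (fun k => chartDiff I (g u) (g (x k)) (mfderiv J I g (x k) (w k))) l
      (𝓝 (show E from mfderiv J I g u v)) := by
  have h1 := ((hg.continuous_tangentMap le_rfl).tendsto _).comp h
  have h2 := (tendsto_tangentBundle_iff I (fun k => g (x k))
    (fun k => mfderiv J I g (x k) (w k)) (g u) (mfderiv J I g u v)).1 h1
  refine h2.2.congr' ?_
  filter_upwards [h2.1 ((chartAt H (g u)).open_source.mem_nhds (mem_chart_source H (g u)))] with k hk
  exact (chartDiff_apply I hk _).symm

theorem isClosed_clarkeTangentCone (S : Set M) (s : M) : IsClosed (clarkeTangentCone I S s) := by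
  have : clarkeTangentCone I S s = ⋂ p ∈ limitingNormalCone I S s, {v | p v ≤ 0} := by
    ext v; simp [clarkeTangentCone]
  rw [this]
  exact isClosed_biInter fun p _ => isClosed_le p.continuous continuous_const

end Curves

/-! ### Separating the summands of a composite function -/

section Decoupling

variable {E' H' N : Type*} [NormedAddCommGroup E'] [NormedSpace ℝ E'] [FiniteDimensional ℝ E']
  [TopologicalSpace H']
  (J : ModelWithCorners ℝ E' H') [TopologicalSpace N] [ChartedSpace H' N]
  [RiemannianBundle (fun x : N => TangentSpace J x)]
  {Y : Type*} [NormedAddCommGroup Y] [NormedSpace ℝ Y] [FiniteDimensional ℝ Y]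

/-- One curve per direction is enough: it is exchanged for its tangent line in `Y`, after which only
the linear map `A` and the Riemannian norm on the tangent space remain. -/
theorem exists_subgradient_of_lowerDini {F : N → ℝ} {u : N} {T : Set (TangentSpace J u)}
    (hT : IsClosed T) (hT0 : (0 : TangentSpace J u) ∈ T) (hTadd : ∀ v ∈ T, ∀ w ∈ T, v + w ∈ T)
    (hTsmul : ∀ v ∈ T, ∀ c : ℝ, 0 ≤ c → c • v ∈ T)
    {γ : N → Y} {f : Y → ℝ} (hF : ∀ᶠ x in 𝓝 u, F x = f (γ x)) (A : TangentSpace J u →L[ℝ] Y)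
    (hA : ∀ (c : ℝ → N) (v : TangentSpace J u), IsSmoothCurveWithVelocity J c u v →
      HasDerivAt (fun t => γ (c t)) (A v) 0)
    {K : NNReal} {s : Set Y} (hs : s ∈ 𝓝 (γ u)) (hf : LipschitzOnWith K f s)
    {Δ : ℝ} (hΔ : 0 ≤ Δ)
    (hdec : ∀ v ∈ T, v ≠ 0 → ∃ c : ℝ → N, IsSmoothCurveWithVelocity J c u v ∧
      ((-(Δ * ‖v‖) : ℝ) : EReal) < lowerDiniAlong F c)
    {δ : ℝ} (hδ : 0 < δ) {W : Set Y} (hW : W ∈ 𝓝 (γ u)) :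
    ∃ y ∈ W, ∃ h : Y → ℝ, ContDiff ℝ ∞ h ∧ IsLocalMin (fun x => f x - h x) y ∧
      ∀ w ∈ T, -((Δ + δ) * ‖w‖) ≤ fderiv ℝ h y (A w) := by
  have : FiniteDimensional ℝ (TangentSpace J u) := inferInstanceAs (FiniteDimensional ℝ E')
  refine exists_subgradient_of_increment_ge A hT hT0 hTadd hTsmul hs hf hΔ ?_ hδ hW
  intro v hv η hη
  by_cases hv0 : v = 0
  · filter_upwards [self_mem_nhdsWithin] with t ht
    have ht : 0 < t := ht
    simp only [hv0, map_zero, smul_zero, add_zero, sub_self, norm_zero, mul_zero, zero_add]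
    nlinarith
  · obtain ⟨c, hc, hlt⟩ := hdec v hv hv0
    have hc0 : c 0 = u := hc.2.1
    have hev := eventually_lt_of_lt_liminf hlt
    have hcc : ∀ᶠ t in 𝓝 (0 : ℝ), F (c t) = f (γ (c t)) := by
      have : ContinuousAt c 0 := hc.1.continuous.continuousAt
      rw [← hc0] at hF
      exact this.eventually hF
    have hev' : ∀ᶠ t in 𝓝[>] (0 : ℝ), -(Δ * ‖v‖) < (f (γ (c t)) - f (γ (c 0))) / t := by
      filter_upwards [hev, nhdsWithin_le_nhds hcc] with t h1 h2
      rw [← h2, ← hcc.self_of_nhds]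
      exact EReal.coe_lt_coe_iff.1 h1
    have := increment_ge_of_curve (c := fun t => γ (c t)) (by rwa [hc0]) hf (hA c v hc) hev' hη
    rw [hc0] at this
    filter_upwards [this] with t ht
    linarith

end Decoupling

section Decoupling

variable {E' H' N : Type*} [NormedAddCommGroup E'] [NormedSpace ℝ E'] [FiniteDimensional ℝ E']
  [TopologicalSpace H']
  (J : ModelWithCorners ℝ E' H') [TopologicalSpace N] [ChartedSpace H' N]
  [RiemannianBundle (fun x : N => TangentSpace J x)]
  {X Z : Type*} [NormedAddCommGroup X] [NormedSpace ℝ X] [FiniteDimensional ℝ X]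
  [NormedAddCommGroup Z] [NormedSpace ℝ Z] [FiniteDimensional ℝ Z]
  {κ : Type*} [Fintype κ] [DecidableEq κ] {Y : κ → Type*} [∀ j, NormedAddCommGroup (Y j)]
  [∀ j, NormedSpace ℝ (Y j)] [∀ j, FiniteDimensional ℝ (Y j)]

/-- On the product of the target spaces the summands depend on separate variables, so a function
touching their sum touches each summand after restriction to a slice, and its derivative is the sum
of the partial ones. -/
theorem exists_decoupled_subgradients {F : N → ℝ} {u : N} {T : Set (TangentSpace J u)}
    (hT : IsClosed T) (hT0 : (0 : TangentSpace J u) ∈ T) (hTadd : ∀ v ∈ T, ∀ w ∈ T, v + w ∈ T)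
    (hTsmul : ∀ v ∈ T, ∀ c : ℝ, 0 ≤ c → c • v ∈ T)
    {γX : N → X} {γY : ∀ j, N → Y j} {γZ : N → Z} {fX : X → ℝ} {fY : ∀ j, Y j → ℝ} {fZ : Z → ℝ}
    (hF : ∀ᶠ x in 𝓝 u, F x = fX (γX x) + ∑ j, fY j (γY j x) + fZ (γZ x))
    (AX : TangentSpace J u →L[ℝ] X) (AY : ∀ j, TangentSpace J u →L[ℝ] Y j)
    (AZ : TangentSpace J u →L[ℝ] Z)
    (hAX : ∀ (c : ℝ → N) (v : TangentSpace J u), IsSmoothCurveWithVelocity J c u v →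
      HasDerivAt (fun t => γX (c t)) (AX v) 0)
    (hAY : ∀ j, ∀ (c : ℝ → N) (v : TangentSpace J u), IsSmoothCurveWithVelocity J c u v →
      HasDerivAt (fun t => γY j (c t)) (AY j v) 0)
    (hAZ : ∀ (c : ℝ → N) (v : TangentSpace J u), IsSmoothCurveWithVelocity J c u v →
      HasDerivAt (fun t => γZ (c t)) (AZ v) 0)
    {KX : NNReal} {sX : Set X} (hsX : sX ∈ 𝓝 (γX u)) (hfX : LipschitzOnWith KX fX sX)
    {KY : κ → NNReal} {sY : ∀ j, Set (Y j)} (hsY : ∀ j, sY j ∈ 𝓝 (γY j u))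
    (hfY : ∀ j, LipschitzOnWith (KY j) (fY j) (sY j))
    {KZ : NNReal} {sZ : Set Z} (hsZ : sZ ∈ 𝓝 (γZ u)) (hfZ : LipschitzOnWith KZ fZ sZ)
    {Δ : ℝ} (hΔ : 0 ≤ Δ)
    (hdec : ∀ v ∈ T, v ≠ 0 → ∃ c : ℝ → N, IsSmoothCurveWithVelocity J c u v ∧
      ((-(Δ * ‖v‖) : ℝ) : EReal) < lowerDiniAlong F c)
    {δ : ℝ} (hδ : 0 < δ) {WX : Set X} (hWX : WX ∈ 𝓝 (γX u)) {WY : ∀ j, Set (Y j)}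
    (hWY : ∀ j, WY j ∈ 𝓝 (γY j u)) {WZ : Set Z} (hWZ : WZ ∈ 𝓝 (γZ u)) :
    ∃ x ∈ WX, ∃ y : ∀ j, Y j, (∀ j, y j ∈ WY j) ∧ ∃ z ∈ WZ,
      ∃ (hX : X → ℝ) (hY : ∀ j, Y j → ℝ) (hZ : Z → ℝ),
      (ContDiff ℝ ∞ hX ∧ IsLocalMin (fun a => fX a - hX a) x) ∧
      (∀ j, ContDiff ℝ ∞ (hY j) ∧ IsLocalMin (fun a => fY j a - hY j a) (y j)) ∧
      (ContDiff ℝ ∞ hZ ∧ IsLocalMin (fun a => fZ a - hZ a) z) ∧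
      ∀ w ∈ T, -((Δ + δ) * ‖w‖) ≤ fderiv ℝ hX x (AX w) + ∑ j, fderiv ℝ (hY j) (y j) (AY j w) +
        fderiv ℝ hZ z (AZ w) := by
  let f : X × (∀ j, Y j) × Z → ℝ := fun p => fX p.1 + ∑ j, fY j (p.2.1 j) + fZ p.2.2
  have hf : LipschitzOnWith (KX + ∑ j, KY j + KZ) f (sX ×ˢ (Set.pi univ sY) ×ˢ sZ) := by
    refine LipschitzOnWith.of_dist_le_mul fun p hp q hq => ?_
    have d1 : dist p.1 q.1 ≤ dist p q := le_max_left _ _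
    have d2 : ∀ j, dist (p.2.1 j) (q.2.1 j) ≤ dist p q := fun j =>
      (dist_le_pi_dist _ _ j).trans ((le_max_left _ _).trans (le_max_right _ _))
    have d3 : dist p.2.2 q.2.2 ≤ dist p q := (le_max_right _ _).trans (le_max_right _ _)
    have a1 : dist (fX p.1) (fX q.1) ≤ KX * dist p q :=
      (hfX.dist_le_mul _ hp.1 _ hq.1).trans (by gcongr)
    have a2 : ∀ j, dist (fY j (p.2.1 j)) (fY j (q.2.1 j)) ≤ KY j * dist p q := fun j =>
      ((hfY j).dist_le_mul _ (hp.2.1 j trivial) _ (hq.2.1 j trivial)).trans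
        (mul_le_mul_of_nonneg_left (d2 j) (KY j).2)
    have a3 : dist (fZ p.2.2) (fZ q.2.2) ≤ KZ * dist p q :=
      (hfZ.dist_le_mul _ hp.2.2 _ hq.2.2).trans (by gcongr)
    calc dist (f p) (f q) ≤ dist (fX p.1) (fX q.1) +
          ∑ j, dist (fY j (p.2.1 j)) (fY j (q.2.1 j)) + dist (fZ p.2.2) (fZ q.2.2) :=
          (dist_add_add_le _ _ _ _).trans (by
            gcongr
            exact (dist_add_add_le _ _ _ _).trans (by gcongr; exact dist_sum_sum_le _ _ _))
      _ ≤ KX * dist p q + ∑ j, KY j * dist p q + KZ * dist p q := by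
          gcongr with j; exact a2 j
      _ = _ := by push_cast; rw [← Finset.sum_mul]; ring
  let A : TangentSpace J u →L[ℝ] X × (∀ j, Y j) × Z :=
    AX.prod ((ContinuousLinearMap.pi AY).prod AZ)
  obtain ⟨p, ⟨hp1, hp2, hp3⟩, h, hh, hm, hw⟩ := exists_subgradient_of_lowerDini J hT hT0 hTadd hTsmul
    (γ := fun x => (γX x, (fun j => γY j x), γZ x)) (f := f) hF A
    (fun c v hc => (hAX c v hc).prodMk ((hasDerivAt_pi.2 fun j => hAY j c v hc).prodMk (hAZ c v hc)))
    (prod_mem_nhds hsX (prod_mem_nhds (set_pi_mem_nhds finite_univ fun j _ => hsY j) hsZ)) hf hΔ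
    hdec hδ
    (prod_mem_nhds hWX (prod_mem_nhds (set_pi_mem_nhds finite_univ fun j _ => hWY j) hWZ))
  let LX : X →L[ℝ] X × (∀ j, Y j) × Z := ContinuousLinearMap.inl ℝ _ _
  let LY : ∀ j, Y j →L[ℝ] X × (∀ j, Y j) × Z := fun j => ContinuousLinearMap.inr ℝ _ _ ∘L
    (ContinuousLinearMap.inl ℝ _ _ ∘L ContinuousLinearMap.single ℝ Y j)
  let LZ : Z →L[ℝ] X × (∀ j, Y j) × Z := ContinuousLinearMap.inr ℝ _ _ ∘L
    ContinuousLinearMap.inr ℝ _ _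
  obtain ⟨x1, x2, x3⟩ := isLocalMin_slice hh hm LX p.1 (φ := fX)
    (r := ∑ j, fY j (p.2.1 j) + fZ p.2.2) fun z => by simp [f, LX, add_assoc]
  have hj := fun j => isLocalMin_slice hh hm (LY j) (p.2.1 j) (φ := fY j)
    (r := fX p.1 + ∑ i ∈ Finset.univ.erase j, fY i (p.2.1 i) + fZ p.2.2) fun z => by
      have : ∑ i, fY i ((p.2.1 + Pi.single j (z - p.2.1 j)) i) =
          fY j z + ∑ i ∈ Finset.univ.erase j, fY i (p.2.1 i) := by
        rw [← Finset.add_sum_erase _ _ (Finset.mem_univ j)]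
        congr 1
        · simp
        · refine Finset.sum_congr rfl fun i hi => ?_
          simp [Finset.ne_of_mem_erase hi]
      simp only [f, LY, ContinuousLinearMap.comp_apply, ContinuousLinearMap.inr_apply,
        ContinuousLinearMap.inl_apply, ContinuousLinearMap.single_apply, Prod.fst_add, Prod.snd_add,
        this, add_zero]
      ring
  obtain ⟨z1, z2, z3⟩ := isLocalMin_slice hh hm LZ p.2.2 (φ := fZ)
    (r := fX p.1 + ∑ j, fY j (p.2.1 j)) fun z => by simp [f, LZ]; ring
  refine ⟨p.1, hp1, p.2.1, fun j => hp2 j trivial, p.2.2, hp3, _, fun j => _, _, ⟨x1, x2⟩,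
    fun j => ⟨(hj j).1, (hj j).2.1⟩, ⟨z1, z2⟩, fun w hwT => (hw w hwT).trans_eq ?_⟩
  -- Splitting `A w` along the factors breaks the derivative of `h` into the derivatives on the
  -- slices.
  have hAw : A w = LX (AX w) + ∑ j, LY j (AY j w) + LZ (AZ w) := by
    have hs : ∑ j, LY j (AY j w) = (0, (fun j => AY j w), 0) := by
      have : ∑ j, LY j (AY j w) = (ContinuousLinearMap.inr ℝ X _ ∘L
          ContinuousLinearMap.inl ℝ _ Z) (∑ j, Pi.single j (AY j w)) := by
        rw [map_sum]; rfl
      rw [this, Finset.univ_sum_single]; rfl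
    rw [hs]
    simp [A, LX, LZ]
  rw [hAw, map_add, map_add, map_sum, x3, z3]
  simp only [(hj _).2.2]
  rfl

end Decoupling

/-! ### Limits of pairings and norms; test functions near a moving point -/

theorem tendsto_clm_apply {V W : Type*} [NormedAddCommGroup V] [NormedSpace ℝ V]
    [NormedAddCommGroup W] [NormedSpace ℝ W] {α : Type*} {l : Filter α} {p : α → V →L[ℝ] W}
    {w : α → V} {p₀ : V →L[ℝ] W} {w₀ : V} (hp : Tendsto p l (𝓝 p₀)) (hw : Tendsto w l (𝓝 w₀)) :
    Tendsto (fun k => p k (w k)) l (𝓝 (p₀ w₀)) :=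
  ((isBoundedBilinearMap_apply (𝕜 := ℝ) (E := V) (F := W)).continuous.tendsto (p₀, w₀)).comp
    (hp.prodMk_nhds hw)

section Norm

variable {E H M : Type*} [NormedAddCommGroup E] [NormedSpace ℝ E] [TopologicalSpace H]
  (I : ModelWithCorners ℝ E H) [TopologicalSpace M] [ChartedSpace H M]

theorem tendsto_norm_of_tendsto_tangentBundle [IsManifold I 1 M]
    [RiemannianBundle (fun x : M => TangentSpace I x)]
    [IsContinuousRiemannianBundle E (fun x : M => TangentSpace I x)] {α : Type*} {l : Filter α}
    {x : α → M} {w : ∀ k, TangentSpace I (x k)} {s : M} {v : TangentSpace I s}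
    (h : Tendsto (fun k => (⟨x k, w k⟩ : TangentBundle I M)) l (𝓝 ⟨s, v⟩)) :
    Tendsto (fun k => ‖w k‖) l (𝓝 ‖v‖) := by
  have h1 : ContinuousAt (fun p : TotalSpace E (fun x : M => TangentSpace I x) =>
      inner ℝ p.2 p.2) ⟨s, v⟩ :=
    ContinuousAt.inner_bundle (F := E) (E := fun x : M => TangentSpace I x)
      (M := TotalSpace E (fun x : M => TangentSpace I x))
      (b := fun p => p.1) (v := fun p => p.2) (w := fun p => p.2) continuousAt_id continuousAt_id
  have h2 := (h1.tendsto.comp h).sqrt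
  simpa only [Function.comp_def, real_inner_self_eq_norm_sq, Real.sqrt_sq (norm_nonneg _)] using h2

/-- The chart, the constant and the set are fixed at `g u₀` and serve all parameters and all `u`
near `u₀`. -/
theorem eventually_chart_lipschitz [I.Boundaryless] {P : Type*} {φ : P → M → ℝ}
    (hφ : IsConstraintFunction I φ)
    {X : Type*} [TopologicalSpace X] {g : X → M} {u₀ : X} (hg : ContinuousAt g u₀) :
    ∃ (K : NNReal) (t : Set E), (∀ e, LipschitzOnWith K (φ e ∘ (extChartAt I (g u₀)).symm) t) ∧
      ∀ᶠ u in 𝓝 u₀, g u ∈ (chartAt H (g u₀)).source ∧ t ∈ 𝓝 (extChartAt I (g u₀) (g u)) ∧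
        (extChartAt I (g u₀)).target ∈ 𝓝 (extChartAt I (g u₀) (g u)) := by
  obtain ⟨K, t, ht, hL⟩ := hφ.locallyLipschitz (g u₀)
  rw [I.range_eq_univ, nhdsWithin_univ] at ht
  refine ⟨K, t, hL, ?_⟩
  have hc : ContinuousAt (fun u => extChartAt I (g u₀) (g u)) u₀ :=
    (continuousAt_extChartAt (I := I) (g u₀)).comp hg
  filter_upwards [hg ((chartAt H (g u₀)).open_source.mem_nhds (mem_chart_source H (g u₀))),
    hc.eventually (eventually_mem_nhds_iff.2 ht),
    hc.eventually (eventually_mem_nhds_iff.2 (extChartAt_target_mem_nhds (I := I) (g u₀)))]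
    with u h1 h2 h3
  exact ⟨h1, h2, h3⟩

end Norm

/-- The implication lets test points be chosen without knowing which summands of the penalty are
positive. -/
theorem pos_mem_nhds_of_lipschitzOnWith {E : Type*} [PseudoEMetricSpace E] {f : E → ℝ} {K : NNReal} {t : Set E} {y : E} (ht : t ∈ 𝓝 y)
    (hf : LipschitzOnWith K f t) : {z | 0 < f y → 0 < f z} ∈ 𝓝 y := by
  by_cases h : 0 < f y
  · filter_upwards [(hf.continuousOn.continuousAt ht).eventually (lt_mem_nhds h)] with z hz _
    exact hz
  · exact univ_mem' fun z hz => absurd hz h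

/-- `h` is a smooth function on the chart at `s` touching `f` from below at the point with
coordinates `x`, which is `r`-close to `q`, and where `f` is positive if it is positive at `q`. -/
structure IsNearbyTest {E H M : Type*} [NormedAddCommGroup E] [NormedSpace ℝ E]
    [TopologicalSpace H] (I : ModelWithCorners ℝ E H) [TopologicalSpace M] [ChartedSpace H M]
    (f : M → ℝ) (s q : M) (r : ℝ) (x : E) (h : E → ℝ) : Prop where
  mem_target : x ∈ (extChartAt I s).target
  dist_lt : dist x (extChartAt I s q) < r
  pos : 0 < f q → 0 < f ((extChartAt I s).symm x)
  contDiff : ContDiff ℝ ∞ h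
  isLocalMin : IsLocalMin (fun a => f ((extChartAt I s).symm a) - h a) x

section Tests

variable {E H M : Type*} [NormedAddCommGroup E] [NormedSpace ℝ E]
    [TopologicalSpace H] (I : ModelWithCorners ℝ E H) [TopologicalSpace M] [ChartedSpace H M]

theorem tendsto_of_isNearbyTest {f : ℕ → M → ℝ} {s : M} {q : ℕ → M} {x : ℕ → E} {h : ℕ → E → ℝ}
    (ht : ∀ k : ℕ, IsNearbyTest I (f k) s (q k) (1 / (k + 1)) (x k) (h k))
    (hq : Tendsto q atTop (𝓝 s)) : Tendsto x atTop (𝓝 (extChartAt I s s)) := by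
  have h1 : Tendsto (fun k => extChartAt I s (q k)) atTop (𝓝 (extChartAt I s s)) :=
    (continuousAt_extChartAt (I := I) s).tendsto.comp hq
  refine h1.congr_dist (squeeze_zero (fun _ => dist_nonneg) (fun k => ?_)
    tendsto_one_div_add_atTop_nhds_zero_nat)
  rw [dist_comm]
  exact (ht k).dist_lt.le

theorem test_nhds {f : M → ℝ} {K : NNReal} {t : Set E} {s q : M} {r : ℝ} (hr : 0 < r)
    (ht : t ∈ 𝓝 (extChartAt I s q)) (hT : (extChartAt I s).target ∈ 𝓝 (extChartAt I s q))
    (hf : LipschitzOnWith K (f ∘ (extChartAt I s).symm) t) (hq : q ∈ (chartAt H s).source) :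
    {x | x ∈ (extChartAt I s).target ∧ dist x (extChartAt I s q) < r ∧
      (0 < f q → 0 < f ((extChartAt I s).symm x))} ∈ 𝓝 (extChartAt I s q) := by
  have h := pos_mem_nhds_of_lipschitzOnWith ht hf
  filter_upwards [h, hT, Metric.ball_mem_nhds _ hr] with x h1 h2 h3
  refine ⟨h2, h3, fun h4 => h1 ?_⟩
  rwa [Function.comp, (extChartAt I s).left_inv (by rwa [extChartAt_source])]

end Tests

/-! ### The multiplier criterion for strong decrease -/

section Composite

variable {ι : Type*} [Fintype ι] [DecidableEq ι] {E : ι → Type*} [∀ i, NormedAddCommGroup (E i)]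
  [∀ i, NormedSpace ℝ (E i)]
  {H : ι → Type*} [∀ i, TopologicalSpace (H i)]
  (I : ∀ i, ModelWithCorners ℝ (E i) (H i))
  {M : ι → Type*} [∀ i, TopologicalSpace (M i)] [∀ i, ChartedSpace (H i) (M i)]
  [∀ i, IsManifold (I i) ∞ (M i)]

theorem tendsto_piTangentSingle {α : Type*} {l : Filter α} {x : α → ∀ i, M i} {i : ι}
    {w : ∀ k, TangentSpace (I i) (x k i)} {u : ∀ i, M i} {v : TangentSpace (I i) (u i)}
    (hx : Tendsto x l (𝓝 u))
    (h : Tendsto (fun k => (⟨x k i, w k⟩ : TangentBundle (I i) (M i))) l (𝓝 ⟨u i, v⟩)) :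
    Tendsto (fun k => (⟨x k, piTangentSingle I (x k) i (w k)⟩ :
      TangentBundle (ModelWithCorners.pi I) (∀ i, M i))) l (𝓝 ⟨u, piTangentSingle I u i v⟩) := by
  rw [tendsto_tangentBundle_iff] at h ⊢
  refine ⟨hx, ?_⟩
  have h2 := ((ContinuousLinearMap.single ℝ E i).continuous.tendsto _).comp h.2
  refine h2.congr' ?_
  filter_upwards [hx ((isOpen_extChartAt_source (I := ModelWithCorners.pi I) u).mem_nhds
      (mem_extChartAt_source u))] with k hk
  exact (tangentCoordChange_pi_single I (x k) u (x k) (mem_extChartAt_source _) hk i (w k)).symm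

variable [∀ i, FiniteDimensional ℝ (E i)] [∀ i, T2Space (M i)]
  [∀ i, RiemannianBundle (fun x : M i => TangentSpace (I i) x)]
  [∀ i, IsContinuousRiemannianBundle (E i) (fun x : M i => TangentSpace (I i) x)]
  {P : Type*} [PseudoMetricSpace P]
  {EX HX X EZ HZ Z : Type*} [NormedAddCommGroup EX] [NormedSpace ℝ EX] [FiniteDimensional ℝ EX]
  [TopologicalSpace HX] {IX : ModelWithCorners ℝ EX HX} [IX.Boundaryless] [TopologicalSpace X]
  [ChartedSpace HX X] [T2Space X] [IsManifold IX ∞ X]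
  [RiemannianBundle (fun x : X => TangentSpace IX x)]
  [IsContinuousRiemannianBundle EX (fun x : X => TangentSpace IX x)]
  [NormedAddCommGroup EZ] [NormedSpace ℝ EZ] [FiniteDimensional ℝ EZ]
  [TopologicalSpace HZ] {IZ : ModelWithCorners ℝ EZ HZ} [IZ.Boundaryless] [TopologicalSpace Z]
  [ChartedSpace HZ Z] [T2Space Z] [IsManifold IZ ∞ Z]
  [RiemannianBundle (fun x : Z => TangentSpace IZ x)]
  [IsContinuousRiemannianBundle EZ (fun x : Z => TangentSpace IZ x)]
  {κ : Type*} [Fintype κ] [DecidableEq κ] {EY HY Y : κ → Type*} [∀ j, NormedAddCommGroup (EY j)]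
  [∀ j, NormedSpace ℝ (EY j)] [∀ j, FiniteDimensional ℝ (EY j)] [∀ j, TopologicalSpace (HY j)]
  {IY : ∀ j, ModelWithCorners ℝ (EY j) (HY j)} [∀ j, (IY j).Boundaryless]
  [∀ j, TopologicalSpace (Y j)]
  [∀ j, ChartedSpace (HY j) (Y j)] [∀ j, T2Space (Y j)] [∀ j, IsManifold (IY j) ∞ (Y j)]
  [∀ j, RiemannianBundle (fun x : Y j => TangentSpace (IY j) x)]
  [∀ j, IsContinuousRiemannianBundle (EY j) (fun x : Y j => TangentSpace (IY j) x)]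

/-- The strong decrease condition for a sum of constraint functions composed with `C¹` maps: it
holds when the multiplier rule at the reference point has only trivial solutions. -/
theorem strongDecrease_of_forall_multiplier_eq_zero
    {S : ∀ i, Set (M i)} (hS : ∀ i, ClarkeRegular (I i) (S i))
    {e₀ : P} {u₀ : ∀ i, M i} (hu₀ : ∀ i, u₀ i ∈ S i)
    {φX : P → X → ℝ} {φY : ∀ j, P → Y j → ℝ} {φZ : P → Z → ℝ}
    (hX : IsConstraintFunction IX φX) (hY : ∀ j, IsConstraintFunction (IY j) (φY j))
    (hZ : IsConstraintFunction IZ φZ)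
    {gX : (∀ i, M i) → X} {gY : ∀ j, (∀ i, M i) → Y j} {gZ : (∀ i, M i) → Z}
    (hgX : ContMDiff (ModelWithCorners.pi I) IX 1 gX)
    (hgY : ∀ j, ContMDiff (ModelWithCorners.pi I) (IY j) 1 (gY j))
    (hgZ : ContMDiff (ModelWithCorners.pi I) IZ 1 gZ)
    (hrX : IsPhiRegular IX φX e₀ (gX u₀)) (hrY : ∀ j, IsPhiRegular (IY j) (φY j) e₀ (gY j u₀))
    (hrZ : IsPhiRegular IZ φZ e₀ (gZ u₀))
    (hN : ∀ (pX : Cotangent IX (gX u₀)) (pY : ∀ j, Cotangent (IY j) (gY j u₀))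
      (pZ : Cotangent IZ (gZ u₀)),
      pX ∈ limitingSubdiffReal IX (φX e₀) (gX u₀) →
      (∀ j, pY j ∈ limitingSubdiffReal (IY j) (φY j e₀) (gY j u₀)) →
      pZ ∈ limitingSubdiffReal IZ (φZ e₀) (gZ u₀) →
      (∀ i, ∀ v ∈ clarkeTangentCone (I i) (S i) (u₀ i),
        0 ≤ pX (mfderiv (ModelWithCorners.pi I) IX gX u₀ (piTangentSingle I u₀ i v)) +
          ∑ j, pY j (mfderiv (ModelWithCorners.pi I) (IY j) (gY j) u₀ (piTangentSingle I u₀ i v)) +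
          pZ (mfderiv (ModelWithCorners.pi I) IZ gZ u₀ (piTangentSingle I u₀ i v))) →
      pX = 0 ∧ (∀ j, pY j = 0) ∧ pZ = 0) :
    StrongDecrease (ModelWithCorners.pi I)
      (fun e u => φX e (gX u) + ∑ j, φY j e (gY j u) + φZ e (gZ u)) {u | ∀ i, u i ∈ S i} e₀ u₀ := by
  have : ∀ i, LocallyCompactSpace (M i) := fun i => Manifold.locallyCompact_of_finiteDimensional (I i)
  obtain ⟨KX, tX, hLX, hGX⟩ := eventually_chart_lipschitz IX hX hgX.continuous.continuousAt (u₀ := u₀)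
  choose KY tY hLY hGY using fun j =>
    eventually_chart_lipschitz (IY j) (hY j) (hgY j).continuous.continuousAt (u₀ := u₀)
  obtain ⟨KZ, tZ, hLZ, hGZ⟩ := eventually_chart_lipschitz IZ hZ hgZ.continuous.continuousAt (u₀ := u₀)
  have hG := (hGX.and (eventually_all.2 hGY)).and hGZ
  obtain ⟨ε₀, hε₀, hsub⟩ := setOfPred_riemannianEDist_lt_subset_nhds (ModelWithCorners.pi I) hG
  by_contra hcon
  have step : ∀ k : ℕ, ∃ (e : P) (u : ∀ i, M i) (x : EX) (y : ∀ j, EY j) (z : EZ) (fX : EX → ℝ)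
      (fY : ∀ j, EY j → ℝ) (fZ : EZ → ℝ),
      edist e e₀ < ENNReal.ofReal (1 / (k + 1)) ∧
      Manifold.riemannianEDist (ModelWithCorners.pi I) u u₀ < ENNReal.ofReal (1 / (k + 1)) ∧
      (∀ i, u i ∈ S i) ∧ 0 < φX e (gX u) + ∑ j, φY j e (gY j u) + φZ e (gZ u) ∧
      IsNearbyTest IX (φX e) (gX u₀) (gX u) (1 / (k + 1)) x fX ∧
      (∀ j, IsNearbyTest (IY j) (φY j e) (gY j u₀) (gY j u) (1 / (k + 1)) (y j) (fY j)) ∧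
      IsNearbyTest IZ (φZ e) (gZ u₀) (gZ u) (1 / (k + 1)) z fZ ∧
      ∀ w ∈ clarkeTangentCone (ModelWithCorners.pi I) {u | ∀ i, u i ∈ S i} u,
        -((1 / (k + 1) + 1 / (k + 1)) * ‖w‖) ≤
          fderiv ℝ fX x (chartDiff IX (gX u₀) (gX u)
            (mfderiv (ModelWithCorners.pi I) IX gX u w)) +
          ∑ j, fderiv ℝ (fY j) (y j) (chartDiff (IY j) (gY j u₀) (gY j u)
            (mfderiv (ModelWithCorners.pi I) (IY j) (gY j) u w)) +
          fderiv ℝ fZ z (chartDiff IZ (gZ u₀) (gZ u)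
            (mfderiv (ModelWithCorners.pi I) IZ gZ u w)) := by
    intro k
    have hk : (0 : ℝ) < 1 / (k + 1) := by positivity
    unfold StrongDecrease at hcon
    push Not at hcon
    -- The failure of strong decrease is used with rate `1 / (k + 1)` and a radius below `ε₀`,
    -- within which the chart and Lipschitz data at `u₀` are valid. The same number then serves as
    -- slack `δ` and as distance of the test points.
    obtain ⟨e, u, huS, hpos, hdist, hall⟩ :=
      hcon (min (ε₀ : ℝ) (1 / (k + 1))) (lt_min (by exact_mod_cast hε₀) hk) (1 / (k + 1)) hk
    have hd1 := (le_self_add.trans_lt hdist).trans_le (ENNReal.ofReal_le_ofReal (min_le_left _ _))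
    have hd2 := (le_self_add.trans_lt hdist).trans_le (ENNReal.ofReal_le_ofReal (min_le_right _ _))
    have hd3 := (le_add_self.trans_lt hdist).trans_le (ENNReal.ofReal_le_ofReal (min_le_right _ _))
    have hmem : u ∈ {y | Manifold.riemannianEDist (ModelWithCorners.pi I) u₀ y < ε₀} := by
      rw [Manifold.riemannianEDist_comm] at hd1
      simpa using hd1
    obtain ⟨⟨⟨gX1, gX2, gX3⟩, gY'⟩, gZ1, gZ2, gZ3⟩ := hsub hmem
    have iX : ∀ x, gX x ∈ (chartAt HX (gX u₀)).source →
        (extChartAt IX (gX u₀)).symm (extChartAt IX (gX u₀) (gX x)) = gX x := fun x hx =>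
      (extChartAt IX (gX u₀)).left_inv (by rwa [extChartAt_source])
    have iY : ∀ j x, gY j x ∈ (chartAt (HY j) (gY j u₀)).source →
        (extChartAt (IY j) (gY j u₀)).symm (extChartAt (IY j) (gY j u₀) (gY j x)) = gY j x :=
      fun j x hx => (extChartAt (IY j) (gY j u₀)).left_inv (by rwa [extChartAt_source])
    have iZ : ∀ x, gZ x ∈ (chartAt HZ (gZ u₀)).source →
        (extChartAt IZ (gZ u₀)).symm (extChartAt IZ (gZ u₀) (gZ x)) = gZ x := fun x hx =>
      (extChartAt IZ (gZ u₀)).left_inv (by rwa [extChartAt_source])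
    have hF : ∀ᶠ x in 𝓝 u, φX e (gX x) + ∑ j, φY j e (gY j x) + φZ e (gZ x) =
        (φX e ∘ (extChartAt IX (gX u₀)).symm) (extChartAt IX (gX u₀) (gX x)) +
        ∑ j, (φY j e ∘ (extChartAt (IY j) (gY j u₀)).symm) (extChartAt (IY j) (gY j u₀) (gY j x)) +
        (φZ e ∘ (extChartAt IZ (gZ u₀)).symm) (extChartAt IZ (gZ u₀) (gZ x)) := by
      filter_upwards [hgX.continuous.continuousAt ((chartAt HX (gX u₀)).open_source.mem_nhds gX1),
        hgZ.continuous.continuousAt ((chartAt HZ (gZ u₀)).open_source.mem_nhds gZ1),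
        eventually_all.2 fun j => (hgY j).continuous.continuousAt
          ((chartAt (HY j) (gY j u₀)).open_source.mem_nhds (gY' j).1)] with x hxX hxZ hxY
      simp only [Function.comp, iX x hxX, iZ x hxZ]
      congr 2
      exact Finset.sum_congr rfl fun j _ => by rw [iY j x (hxY j)]
    obtain ⟨x, hx, y, hy, z, hz, fX, fY, fZ, hfX, hfY, hfZ, hw⟩ :=
      exists_decoupled_subgradients (ModelWithCorners.pi I) (u := u)
      (T := clarkeTangentCone (ModelWithCorners.pi I) {u | ∀ i, u i ∈ S i} u)
      (isClosed_clarkeTangentCone _ _ _) (fun p _ => by simp)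
      (fun v hv w hw p hp => by rw [map_add]; exact add_nonpos (hv p hp) (hw p hp))
      (fun v hv c hc p hp => by
        rw [map_smul]; exact mul_nonpos_of_nonneg_of_nonpos hc (hv p hp))
      hF (chartDiff IX (gX u₀) (gX u) ∘L mfderiv (ModelWithCorners.pi I) IX gX u)
      (fun j => chartDiff (IY j) (gY j u₀) (gY j u) ∘L
        mfderiv (ModelWithCorners.pi I) (IY j) (gY j) u)
      (chartDiff IZ (gZ u₀) (gZ u) ∘L mfderiv (ModelWithCorners.pi I) IZ gZ u)
      (fun c v hc => hasDerivAt_chart_comp_curve IX _ hgX gX1 hc)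
      (fun j c v hc => hasDerivAt_chart_comp_curve (IY j) _ (hgY j) (gY' j).1 hc)
      (fun c v hc => hasDerivAt_chart_comp_curve IZ _ hgZ gZ1 hc)
      gX2 (hLX e) (fun j => (gY' j).2.1) (fun j => hLY j e) gZ2 (hLZ e) hk.le hall hk
      (test_nhds IX hk gX2 gX3 (hLX e) gX1)
      (fun j => test_nhds (IY j) hk (gY' j).2.1 (gY' j).2.2 (hLY j e) (gY' j).1)
      (test_nhds IZ hk gZ2 gZ3 (hLZ e) gZ1)
    exact ⟨e, u, x, y, z, fX, fY, fZ, hd3, hd2, huS, hpos,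
      ⟨hx.1, hx.2.1, hx.2.2, hfX.1, hfX.2⟩,
      fun j => ⟨(hy j).1, (hy j).2.1, (hy j).2.2, (hfY j).1, (hfY j).2⟩,
      ⟨hz.1, hz.2.1, hz.2.2, hfZ.1, hfZ.2⟩, hw⟩
  choose e u x y z fX fY fZ he hu huS hpos tX tY tZ hw using step
  have hinv : Tendsto (fun k : ℕ => ENNReal.ofReal (1 / ((k : ℝ) + 1))) atTop (𝓝 0) := by
    simpa using ENNReal.tendsto_ofReal tendsto_one_div_add_atTop_nhds_zero_nat
  have he' : Tendsto e atTop (𝓝 e₀) := by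
    rw [tendsto_iff_edist_tendsto_0]
    exact tendsto_of_tendsto_of_tendsto_of_le_of_le tendsto_const_nhds hinv
      (fun _ => zero_le) fun k => (he k).le
  have hu' : Tendsto u atTop (𝓝 u₀) := by
    intro s hs
    obtain ⟨c, hc, hcs⟩ := setOfPred_riemannianEDist_lt_subset_nhds (ModelWithCorners.pi I) hs
    change ∀ᶠ k in atTop, u k ∈ s
    filter_upwards [hinv.eventually (gt_mem_nhds (show (0 : ℝ≥0∞) < c by exact_mod_cast hc))]
      with k hk
    refine hcs ?_
    have := (hu k).trans hk
    rwa [Manifold.riemannianEDist_comm] at this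
  have hqX : Tendsto (fun k => gX (u k)) atTop (𝓝 (gX u₀)) := (hgX.continuous.tendsto _).comp hu'
  have hqY : ∀ j, Tendsto (fun k => gY j (u k)) atTop (𝓝 (gY j u₀)) := fun j =>
    ((hgY j).continuous.tendsto _).comp hu'
  have hqZ : Tendsto (fun k => gZ (u k)) atTop (𝓝 (gZ u₀)) := (hgZ.continuous.tendsto _).comp hu'
  have hx := tendsto_of_isNearbyTest IX tX hqX
  have hy := fun j => tendsto_of_isNearbyTest (IY j) (fun k => tY k j) (hqY j)
  have hz := tendsto_of_isNearbyTest IZ tZ hqZ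
  -- Subsequences are extracted in turn for `X`, for `Z` and for the finite family `Y`, each within
  -- the preceding one.
  obtain ⟨σ₁, hσ₁, pX, hpX, lX⟩ := hrX.exists_subseq_chart IX he' hx (fun k => (tX k).mem_target)
    (fun k => (tX k).contDiff) (fun k => (tX k).isLocalMin)
  have aσ₁ := hσ₁.tendsto_atTop
  obtain ⟨σ₂, hσ₂, pZ, hpZ, lZ⟩ := hrZ.exists_subseq_chart IZ (he'.comp aσ₁) (hz.comp aσ₁)
    (fun k => (tZ _).mem_target) (fun k => (tZ _).contDiff) (fun k => (tZ _).isLocalMin)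
  obtain ⟨τ, hτ, hτY⟩ := exists_common_subseq (ι := κ)
    (R := fun j σ => ∃ p ∈ limitingSubdiffReal (IY j) (φY j e₀) (gY j u₀),
      Tendsto (fun k => fderiv ℝ (fY (σ k) j) (y (σ k) j)) atTop
        (𝓝 (show EY j →L[ℝ] ℝ from p)))
    (fun j σ τ ⟨p, hp, hl⟩ hτ => ⟨p, hp, hl.comp hτ.tendsto_atTop⟩)
    (fun j σ hσ => by
      obtain ⟨τ, hτ, p, hp, hl⟩ := (hrY j).exists_subseq_chart (IY j) (he'.comp hσ.tendsto_atTop)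
        ((hy j).comp hσ.tendsto_atTop)
        (fun k => (tY _ j).mem_target) (fun k => (tY _ j).contDiff) (fun k => (tY _ j).isLocalMin)
      exact ⟨τ, hτ, p, hp, hl⟩)
    (hσ₁.comp hσ₂)
  choose pY hpY lY using hτY
  set σ := (σ₁ ∘ σ₂) ∘ τ with hσd
  have hσ : StrictMono σ := (hσ₁.comp hσ₂).comp hτ
  have aσ := hσ.tendsto_atTop
  have lX' : Tendsto (fun k => fderiv ℝ (fX (σ k)) (x (σ k))) atTop
      (𝓝 (show EX →L[ℝ] ℝ from pX)) := lX.comp (hσ₂.comp hτ).tendsto_atTop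
  have lZ' : Tendsto (fun k => fderiv ℝ (fZ (σ k)) (z (σ k))) atTop
      (𝓝 (show EZ →L[ℝ] ℝ from pZ)) := lZ.comp hτ.tendsto_atTop
  -- The approximate inequalities hold only at `u (σ k)`; Clarke regularity supplies tangent vectors
  -- there that converge to `v`, and the error term tends to zero.
  obtain ⟨zX, zY, zZ⟩ := hN pX pY pZ hpX hpY hpZ fun i v hv => by
    obtain ⟨w, hwT, hwl⟩ := (hS i).2 (u₀ i) (hu₀ i) v hv (fun k => u (σ k) i)
      (fun k => huS _ i) ((tendsto_pi_nhds.1 (hu'.comp aσ)) i)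
    have hwl' := tendsto_piTangentSingle I (hu'.comp aσ) hwl
    have cX := tendsto_clm_apply lX' (tendsto_chartDiff_mfderiv IX (ModelWithCorners.pi I) hgX hwl')
    have cZ := tendsto_clm_apply lZ' (tendsto_chartDiff_mfderiv IZ (ModelWithCorners.pi I) hgZ hwl')
    have cY := tendsto_finsetSum Finset.univ fun j _ => tendsto_clm_apply (lY j)
      (tendsto_chartDiff_mfderiv (IY j) (ModelWithCorners.pi I) (hgY j) hwl')
    have cn := tendsto_norm_of_tendsto_tangentBundle (ModelWithCorners.pi I) hwl'
    have c0 : Tendsto (fun k : ℕ => 1 / ((σ k : ℝ) + 1)) atTop (𝓝 0) :=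
      tendsto_one_div_add_atTop_nhds_zero_nat.comp aσ
    have cL := ((c0.add c0).mul cn).neg
    simp only [add_zero, zero_mul, neg_zero] at cL
    exact le_of_tendsto_of_tendsto' cL ((cX.add cY).add cZ) fun k =>
      hw (σ k) _ (single_mem_clarkeTangentCone I (hwT k))
  have eX := hrX.eventually_eq_zero_of_tendsto IX hX.nonneg (he'.comp aσ) (hx.comp aσ)
    (fun k => (tX _).mem_target) (fun k => (tX _).contDiff) (fun k => (tX _).isLocalMin)
    (by rw [zX] at lX'; exact lX')
  have eZ := hrZ.eventually_eq_zero_of_tendsto IZ hZ.nonneg (he'.comp aσ) (hz.comp aσ)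
    (fun k => (tZ _).mem_target) (fun k => (tZ _).contDiff) (fun k => (tZ _).isLocalMin)
    (by rw [zZ] at lZ'; exact lZ')
  have eY := fun j => (hrY j).eventually_eq_zero_of_tendsto (IY j) (hY j).nonneg (he'.comp aσ)
    ((hy j).comp aσ)
    (fun k => (tY _ j).mem_target) (fun k => (tY _ j).contDiff) (fun k => (tY _ j).isLocalMin)
    (by have := lY j; rw [zY j] at this; exact this)
  obtain ⟨k, ⟨kX, kZ⟩, kY⟩ := ((eX.and eZ).and (eventually_all.2 eY)).exists
  -- A summand positive at `u (σ k)` would be positive at its test point, where it vanishes.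
  have rX : φX (e (σ k)) (gX (u (σ k))) ≤ 0 := not_lt.1 fun h => ((tX (σ k)).pos h).ne' kX
  have rZ : φZ (e (σ k)) (gZ (u (σ k))) ≤ 0 := not_lt.1 fun h => ((tZ (σ k)).pos h).ne' kZ
  have rY : ∀ j, φY j (e (σ k)) (gY j (u (σ k))) ≤ 0 := fun j =>
    not_lt.1 fun h => ((tY (σ k) j).pos h).ne' (kY j)
  have := hpos (σ k)
  linarith [Finset.sum_nonpos fun j (_ : j ∈ Finset.univ) => rY j]

end Composite

/-! ### Linearized dynamics, costates and strict normality -/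

/-- Summation by parts along the linearized dynamics `d (i + 1) = A i (d i) + c i` and the adjoint
equation for `p`. -/
theorem sum_costate_eq {V : Type*} [AddCommGroup V] [Module ℝ V] {m : ℕ}
    {A : Fin (m + 1) → V →ₗ[ℝ] V} {d : Fin (m + 2) → V} {c : Fin (m + 1) → V}
    {a p : Fin (m + 1) → V →ₗ[ℝ] ℝ} (hd0 : d 0 = 0)
    (hd : ∀ i, d i.succ = A i (d i.castSucc) + c i)
    (hpl : p (Fin.last m) = -a (Fin.last m))
    (hp : ∀ (j : Fin m) (x : V), p j.castSucc x = -a j.castSucc x + p j.succ (A j.succ x)) :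
    ∑ j : Fin m, a j.castSucc (d j.succ.castSucc) + a (Fin.last m) (d (Fin.last (m + 1))) =
      -∑ i, p i (c i) := by
  -- Each term is the increment of the pairing of costate and state, less the contribution of the
  -- control, so the sum telescopes. In this indexing `p j` pairs with `d j.succ`.
  have h1 : ∀ j : Fin m, a j.castSucc (d j.succ.castSucc) =
      p j.succ (d j.succ.succ) - p j.castSucc (d j.castSucc.succ) - p j.succ (c j.succ) := by
    intro j
    rw [hd j.succ, map_add, Fin.succ_castSucc, hp]
    ring
  have h2 : a (Fin.last m) (d (Fin.last (m + 1))) = -p (Fin.last m) (d (Fin.last m).succ) := by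
    rw [hpl, Fin.succ_last]; simp
  have h3 := Fin.sum_univ_castSucc fun i : Fin (m + 1) => p i (d i.succ)
  have h4 := Fin.sum_univ_succ fun i : Fin (m + 1) => p i (d i.succ)
  have h5 : p 0 (d (Fin.succ 0)) = p 0 (c 0) := by
    rw [hd 0]; simp [hd0]
  rw [h2, Finset.sum_congr rfl fun j _ => h1 j, Finset.sum_sub_distrib, Finset.sum_sub_distrib,
    Fin.sum_univ_succ fun i => p i (c i)]
  linarith

section States

variable {m : ℕ}
  {EQ : Type*} [NormedAddCommGroup EQ] [NormedSpace ℝ EQ]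
  {Q : Type*} [TopologicalSpace Q] [ChartedSpace EQ Q]
  {EU : Fin (m + 1) → Type*} [∀ i, NormedAddCommGroup (EU i)] [∀ i, NormedSpace ℝ (EU i)]
  {U : Fin (m + 1) → Type*} [∀ i, TopologicalSpace (U i)] [∀ i, ChartedSpace (EU i) (U i)]
  (sys : ControlSystem m EQ Q EU U) (q₀ : Q)

theorem mfderiv_state_zero (u : ∀ i, U i)
    (w : TangentSpace (ModelWithCorners.pi fun i => 𝓘(ℝ, EU i)) u) :
    (mfderiv (ModelWithCorners.pi fun i => 𝓘(ℝ, EU i)) 𝓘(ℝ, EQ)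
      (fun u : ∀ i, U i => sys.state q₀ u 0) u w : EQ) = 0 := by
  have : (fun u : ∀ i, U i => sys.state q₀ u 0) = fun _ => q₀ := rfl
  rw [this, mfderiv_const]
  rfl

variable [∀ i, IsManifold 𝓘(ℝ, EU i) 1 (U i)]

theorem contMDiff_state (i : Fin (m + 2)) :
    ContMDiff (ModelWithCorners.pi fun i => 𝓘(ℝ, EU i)) 𝓘(ℝ, EQ) 1
      (fun u : ∀ i, U i => sys.state q₀ u i) := by
  induction i using Fin.induction with
  | zero => exact contMDiff_const
  | succ i ih =>
    exact (sys.contMDiff_F i).comp (ih.prodMk (contMDiff_eval (fun i => 𝓘(ℝ, EU i)) 1 i))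

theorem mfderiv_state_pair (u : ∀ i, U i) (i : Fin (m + 2)) (j : Fin (m + 1))
    (w : TangentSpace (ModelWithCorners.pi fun i => 𝓘(ℝ, EU i)) u) :
    mfderiv (ModelWithCorners.pi fun i => 𝓘(ℝ, EU i)) (𝓘(ℝ, EQ).prod 𝓘(ℝ, EU j))
      (fun u : ∀ i, U i => (sys.state q₀ u i, u j)) u w =
    (show EQ × EU j from
      (mfderiv (ModelWithCorners.pi fun i => 𝓘(ℝ, EU i)) 𝓘(ℝ, EQ)
        (fun u : ∀ i, U i => sys.state q₀ u i) u w,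
      piTangentProj (fun i => 𝓘(ℝ, EU i)) u j w)) := by
  have h1 := ((contMDiff_state sys q₀ i u).mdifferentiableAt one_ne_zero).hasMFDerivAt
  exact congrArg (fun f : (∀ i, EU i) →L[ℝ] EQ × EU j => f w)
    (h1.prodMk (hasMFDerivAt_eval (fun i => 𝓘(ℝ, EU i)) u j)).mfderiv

/-- This is the linear recursion required by `sum_costate_eq`; its forcing term is the partial
derivative in the control. -/
theorem mfderiv_state_succ (u : ∀ i, U i) (i : Fin (m + 1))
    (w : TangentSpace (ModelWithCorners.pi fun i => 𝓘(ℝ, EU i)) u) :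
    (mfderiv (ModelWithCorners.pi fun i => 𝓘(ℝ, EU i)) 𝓘(ℝ, EQ)
      (fun u : ∀ i, U i => sys.state q₀ u i.succ) u w : EQ) =
    mfderiv 𝓘(ℝ, EQ) 𝓘(ℝ, EQ) (fun q => sys.F i (q, u i)) (sys.state q₀ u i.castSucc)
      (mfderiv (ModelWithCorners.pi fun i => 𝓘(ℝ, EU i)) 𝓘(ℝ, EQ)
        (fun u : ∀ i, U i => sys.state q₀ u i.castSucc) u w) +
    mfderiv 𝓘(ℝ, EU i) 𝓘(ℝ, EQ) (fun c => sys.F i (sys.state q₀ u i.castSucc, c)) (u i)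
      (piTangentProj (fun i => 𝓘(ℝ, EU i)) u i w) := by
  have hF : MDifferentiableAt (𝓘(ℝ, EQ).prod 𝓘(ℝ, EU i)) 𝓘(ℝ, EQ) (sys.F i)
      (sys.state q₀ u i.castSucc, u i) :=
    (sys.contMDiff_F i _).mdifferentiableAt one_ne_zero
  have hg : MDifferentiableAt (ModelWithCorners.pi fun i => 𝓘(ℝ, EU i))
      (𝓘(ℝ, EQ).prod 𝓘(ℝ, EU i)) (fun u : ∀ i, U i => (sys.state q₀ u i.castSucc, u i)) u :=
    ((contMDiff_state sys q₀ i.castSucc u).mdifferentiableAt one_ne_zero).prodMk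
      ((contMDiff_eval (fun i => 𝓘(ℝ, EU i)) 1 i u).mdifferentiableAt one_ne_zero)
  have h1 := (hF.hasMFDerivAt.comp u hg.hasMFDerivAt).mfderiv
  refine (congrArg (fun f : (∀ i, EU i) →L[ℝ] EQ => f w) h1).trans ?_
  refine (mfderiv_prod_eq_add_apply hF).trans ?_
  exact congrArg (fun x : EQ × EU i =>
    (mfderiv 𝓘(ℝ, EQ) 𝓘(ℝ, EQ) (fun q => sys.F i (q, u i)) (sys.state q₀ u i.castSucc) x.1 : EQ) +
    mfderiv 𝓘(ℝ, EU i) 𝓘(ℝ, EQ) (fun c => sys.F i (sys.state q₀ u i.castSucc, c)) (u i) x.2)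
    (mfderiv_state_pair sys q₀ u i.castSucc i w)

/-- The adjoint equation can be solved backwards from the final time. -/
theorem exists_costate {V : Type*} [AddCommGroup V] [Module ℝ V] [TopologicalSpace V]
    {m : ℕ} (A : Fin (m + 1) → V →L[ℝ] V) (a : Fin (m + 1) → V →L[ℝ] ℝ) :
    ∃ p : Fin (m + 1) → V →L[ℝ] ℝ, p (Fin.last m) = -a (Fin.last m) ∧
      ∀ j : Fin m, p j.castSucc = -a j.castSucc + p j.succ ∘L A j.succ := by
  refine ⟨Fin.reverseInduction (motive := fun _ => V →L[ℝ] ℝ) (-a (Fin.last m))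
    fun j x => -a j.castSucc + x ∘L A j.succ, ?_, fun j => ?_⟩
  · rw [Fin.reverseInduction_last]
  · rw [Fin.reverseInduction_castSucc]

variable {P : Type*} [IsManifold 𝓘(ℝ, EQ) 1 Q]

/-- Strict normality in terms of the differentials of the maps from control sequences to the
arguments of the constraint functions. -/
theorem IsStrictlyNormal.eq_zero {Φ : ConstraintFunctions P m EQ Q EU U} {e : P} {u : ∀ i, U i}
    (h : IsStrictlyNormal sys Φ q₀ e u)
    (pX : Cotangent 𝓘(ℝ, EU 0) (u 0))
    (pY : ∀ j : Fin m, Cotangent (𝓘(ℝ, EQ).prod 𝓘(ℝ, EU j.succ))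
      (sys.state q₀ u j.succ.castSucc, u j.succ))
    (pZ : Cotangent 𝓘(ℝ, EQ) (sys.state q₀ u (Fin.last (m + 1))))
    (hX : pX ∈ limitingSubdiffReal 𝓘(ℝ, EU 0) (Φ.initial e) (u 0))
    (hY : ∀ j, pY j ∈ limitingSubdiffReal (𝓘(ℝ, EQ).prod 𝓘(ℝ, EU j.succ)) (Φ.mid j e)
      (sys.state q₀ u j.succ.castSucc, u j.succ))
    (hZ : pZ ∈ limitingSubdiffReal 𝓘(ℝ, EQ) (Φ.final e) (sys.state q₀ u (Fin.last (m + 1))))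
    (hN : ∀ i, ∀ v ∈ clarkeTangentCone 𝓘(ℝ, EU i) (sys.controlSet i) (u i),
      0 ≤ pX (mfderiv (ModelWithCorners.pi fun i => 𝓘(ℝ, EU i)) 𝓘(ℝ, EU 0)
            (fun u : ∀ i, U i => u 0) u (piTangentSingle (fun i => 𝓘(ℝ, EU i)) u i v)) +
        ∑ j : Fin m, pY j (mfderiv (ModelWithCorners.pi fun i => 𝓘(ℝ, EU i))
          (𝓘(ℝ, EQ).prod 𝓘(ℝ, EU j.succ))
          (fun u : ∀ i, U i => (sys.state q₀ u j.succ.castSucc, u j.succ)) u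
            (piTangentSingle (fun i => 𝓘(ℝ, EU i)) u i v)) +
        pZ (mfderiv (ModelWithCorners.pi fun i => 𝓘(ℝ, EU i)) 𝓘(ℝ, EQ)
          (fun u : ∀ i, U i => sys.state q₀ u (Fin.last (m + 1))) u
            (piTangentSingle (fun i => 𝓘(ℝ, EU i)) u i v))) :
    pX = 0 ∧ (∀ j, pY j = 0) ∧ pZ = 0 := by
  let pY' : ∀ j : Fin m, EQ × EU j.succ →L[ℝ] ℝ := pY
  -- The state parts of the mixed covectors and `pZ` form `a`; `pX` and the control parts form `b`.
  -- Since `a` is numbered from time 1 and `b` from time 0, constraint `j` supplies `a j.castSucc`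
  -- and `b j.succ`.
  let a : Fin (m + 1) → EQ →L[ℝ] ℝ :=
    Fin.lastCases (motive := fun _ => EQ →L[ℝ] ℝ) pZ
      fun j => pY' j ∘L ContinuousLinearMap.inl ℝ EQ (EU j.succ)
  let b : ∀ i, EU i →L[ℝ] ℝ :=
    Fin.cases (motive := fun i => EU i →L[ℝ] ℝ) pX
      fun j => pY' j ∘L ContinuousLinearMap.inr ℝ EQ (EU j.succ)
  have ha_last : a (Fin.last m) = pZ := Fin.lastCases_last
  have ha_castSucc : ∀ j, a (Fin.castSucc j) =
      pY' j ∘L ContinuousLinearMap.inl ℝ EQ (EU j.succ) := fun j => Fin.lastCases_castSucc j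
  have hb_succ : ∀ j : Fin m, b j.succ = pY' j ∘L ContinuousLinearMap.inr ℝ EQ (EU j.succ) :=
    fun j => rfl
  have hpY : ∀ (j : Fin m) (x : EQ) (y : EU j.succ),
      pY' j (x, y) = a j.castSucc x + b j.succ y := by
    intro j x y
    rw [ha_castSucc, hb_succ]
    simp [← map_add]
  let A : Fin (m + 1) → EQ →L[ℝ] EQ := fun i =>
    mfderiv 𝓘(ℝ, EQ) 𝓘(ℝ, EQ) (fun q => sys.F i (q, u i)) (sys.state q₀ u i.castSucc)
  let B : ∀ i : Fin (m + 1), EU i →L[ℝ] EQ := fun i =>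
    mfderiv 𝓘(ℝ, EU i) 𝓘(ℝ, EQ) (fun c => sys.F i (sys.state q₀ u i.castSucc, c)) (u i)
  obtain ⟨p, hp_last, hp⟩ := exists_costate A a
  -- Varying only the `i`-th control, the costate absorbs its effect on all later states and leaves
  -- the expression of the `maximum` condition.
  have key : ∀ (i : Fin (m + 1)) (v : EU i),
      pX (mfderiv (ModelWithCorners.pi fun i => 𝓘(ℝ, EU i)) 𝓘(ℝ, EU 0)
            (fun u : ∀ i, U i => u 0) u (piTangentSingle (fun i => 𝓘(ℝ, EU i)) u i v)) +
        ∑ j : Fin m, pY j (mfderiv (ModelWithCorners.pi fun i => 𝓘(ℝ, EU i))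
          (𝓘(ℝ, EQ).prod 𝓘(ℝ, EU j.succ))
          (fun u : ∀ i, U i => (sys.state q₀ u j.succ.castSucc, u j.succ)) u
            (piTangentSingle (fun i => 𝓘(ℝ, EU i)) u i v)) +
        pZ (mfderiv (ModelWithCorners.pi fun i => 𝓘(ℝ, EU i)) 𝓘(ℝ, EQ)
          (fun u : ∀ i, U i => sys.state q₀ u (Fin.last (m + 1))) u
            (piTangentSingle (fun i => 𝓘(ℝ, EU i)) u i v)) = b i v - p i (B i v) := by
    intro i v
    let w : ∀ i, EU i := Pi.single i v
    let d : Fin (m + 2) → EQ := fun k =>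
      mfderiv (ModelWithCorners.pi fun i => 𝓘(ℝ, EU i)) 𝓘(ℝ, EQ)
        (fun u : ∀ i, U i => sys.state q₀ u k) u w
    have h1 : pX (mfderiv (ModelWithCorners.pi fun i => 𝓘(ℝ, EU i)) 𝓘(ℝ, EU 0)
        (fun u : ∀ i, U i => u 0) u (piTangentSingle (fun i => 𝓘(ℝ, EU i)) u i v)) =
        b 0 (w 0) :=
      congrArg (fun f : (∀ i, EU i) →L[ℝ] EU 0 => b 0 (f w))
        (hasMFDerivAt_eval (fun i => 𝓘(ℝ, EU i)) u 0).mfderiv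
    have h2 : ∀ j : Fin m, pY j (mfderiv (ModelWithCorners.pi fun i => 𝓘(ℝ, EU i))
          (𝓘(ℝ, EQ).prod 𝓘(ℝ, EU j.succ))
          (fun u : ∀ i, U i => (sys.state q₀ u j.succ.castSucc, u j.succ)) u
            (piTangentSingle (fun i => 𝓘(ℝ, EU i)) u i v)) =
        a j.castSucc (d j.succ.castSucc) + b j.succ (w j.succ) := fun j =>
      (congrArg (pY' j) (mfderiv_state_pair sys q₀ u j.succ.castSucc j.succ w)).trans
        (hpY j _ _)
    have h3 : pZ (mfderiv (ModelWithCorners.pi fun i => 𝓘(ℝ, EU i)) 𝓘(ℝ, EQ)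
          (fun u : ∀ i, U i => sys.state q₀ u (Fin.last (m + 1))) u
            (piTangentSingle (fun i => 𝓘(ℝ, EU i)) u i v)) =
        a (Fin.last m) (d (Fin.last (m + 1))) := by
      rw [ha_last]; rfl
    have h4 := sum_costate_eq (A := fun i => (A i : EQ →ₗ[ℝ] EQ)) (d := d)
      (c := fun k => B k (w k)) (a := fun i => (a i : EQ →ₗ[ℝ] ℝ))
      (p := fun i => (p i : EQ →ₗ[ℝ] ℝ)) (mfderiv_state_zero sys q₀ u w)
      (fun k => mfderiv_state_succ sys q₀ u k w) (by simp [hp_last])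
      (fun j x => by simp [hp j])
    simp only [ContinuousLinearMap.coe_coe] at h4
    have h5 : ∑ k, (b k (w k) - p k (B k (w k))) = b i v - p i (B i v) := by
      rw [Finset.sum_eq_single i]
      · simp [w]
      · intro k _ hk
        simp [w, Pi.single_eq_of_ne hk]
      · simp
    rw [h1, Finset.sum_congr rfl fun j _ => h2 j, h3, Finset.sum_add_distrib, ← h5,
      Finset.sum_sub_distrib, Fin.sum_univ_succ fun k => b k (w k)]
    linarith
  have hmult : IsMultiplier sys Φ q₀ e u a p b := by
    refine ⟨hX, fun j => ?_, ?_, ?_, fun j w => ?_, fun i v hv => ?_⟩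
    · convert hY j using 1
      ext x
      exact (hpY j x.1 x.2).symm
    · rw [ha_last]; exact hZ
    · exact neg_eq_iff_eq_neg.2 hp_last
    · exact congrArg (fun f : EQ →L[ℝ] ℝ => f w) (hp j)
    · exact (hN i v hv).trans_eq (key i v)
  obtain ⟨ha, hb⟩ := h a p b hmult
  refine ⟨hb 0, fun j => ?_, ha_last.symm.trans (ha _)⟩
  refine ContinuousLinearMap.ext fun x => (hpY j x.1 x.2).trans ?_
  rw [show a j.castSucc = 0 from ha _, show b j.succ = 0 from hb _]
  simp

end States

/-! ### Application to the control system -/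

theorem isContinuousRiemannianBundle_tangentSpace {E H M : Type*} [NormedAddCommGroup E]
    [NormedSpace ℝ E] [TopologicalSpace H] (I : ModelWithCorners ℝ E H) [TopologicalSpace M]
    [ChartedSpace H M] [IsManifold I 1 M] (n : ℕ∞ω)
    [RiemannianBundle (fun x : M => TangentSpace I x)]
    [h : IsContMDiffRiemannianBundle I n E (fun x : M => TangentSpace I x)] :
    IsContinuousRiemannianBundle E (fun x : M => TangentSpace I x) := by
  obtain ⟨g, hg, hg'⟩ := h.exists_contMDiff
  exact ⟨⟨g, hg.continuous, hg'⟩⟩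

end DiscreteControl

end

theorem mainTheorem5
    {P : Type*} [MetricSpace P] {m : ℕ}
    {EQ : Type*} [NormedAddCommGroup EQ] [NormedSpace ℝ EQ] [FiniteDimensional ℝ EQ]
    {Q : Type*} [TopologicalSpace Q] [T2Space Q] [ChartedSpace EQ Q] [IsManifold 𝓘(ℝ, EQ) ∞ Q]
    [RiemannianBundle (fun x : Q => TangentSpace 𝓘(ℝ, EQ) x)]
    [IsContMDiffRiemannianBundle 𝓘(ℝ, EQ) ∞ EQ (fun x : Q => TangentSpace 𝓘(ℝ, EQ) x)]
    {EU : Fin (m + 1) → Type*} [∀ i, NormedAddCommGroup (EU i)] [∀ i, NormedSpace ℝ (EU i)]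
    [∀ i, FiniteDimensional ℝ (EU i)]
    {U : Fin (m + 1) → Type*} [∀ i, TopologicalSpace (U i)] [∀ i, T2Space (U i)]
    [∀ i, ChartedSpace (EU i) (U i)] [∀ i, IsManifold 𝓘(ℝ, EU i) ∞ (U i)]
    [∀ i, RiemannianBundle (fun x : U i => TangentSpace 𝓘(ℝ, EU i) x)]
    [∀ i, IsContMDiffRiemannianBundle 𝓘(ℝ, EU i) ∞ (EU i)
      (fun x : U i => TangentSpace 𝓘(ℝ, EU i) x)]
    (sys : DiscreteControl.ControlSystem m EQ Q EU U)
    (Φ : DiscreteControl.ConstraintFunctions P m EQ Q EU U)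
    (q₀ : Q) (e₀ : P) (u₀ : ∀ i, U i)
    (hfeas : u₀ ∈ DiscreteControl.feasible sys Φ q₀ e₀)
    (hClarke : ∀ i, DiscreteControl.ClarkeRegular 𝓘(ℝ, EU i) (sys.controlSet i))
    (hreg : DiscreteControl.IsRegularAlong sys Φ q₀ e₀ u₀)
    (hnormal : DiscreteControl.IsStrictlyNormal sys Φ q₀ e₀ u₀) :
    DiscreteControl.StrongDecrease (ModelWithCorners.pi (fun i => 𝓘(ℝ, EU i)))
      (DiscreteControl.penalty sys Φ q₀) sys.controls e₀ u₀ := by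
  have : IsContinuousRiemannianBundle EQ (fun x : Q => TangentSpace 𝓘(ℝ, EQ) x) :=
    DiscreteControl.isContinuousRiemannianBundle_tangentSpace 𝓘(ℝ, EQ) ∞
  have : ∀ i, IsContinuousRiemannianBundle (EU i) (fun x : U i => TangentSpace 𝓘(ℝ, EU i) x) :=
    fun i => DiscreteControl.isContinuousRiemannianBundle_tangentSpace 𝓘(ℝ, EU i) ∞
  have h := DiscreteControl.strongDecrease_of_forall_multiplier_eq_zero (fun i => 𝓘(ℝ, EU i))
    hClarke hfeas.1 Φ.initial_spec Φ.mid_spec Φ.final_spec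
    (gX := fun u => u 0) (gY := fun j u => (sys.state q₀ u j.succ.castSucc, u j.succ))
    (gZ := fun u => sys.state q₀ u (Fin.last (m + 1)))
    (DiscreteControl.contMDiff_eval (fun i => 𝓘(ℝ, EU i)) 1 0)
    (fun j => (DiscreteControl.contMDiff_state sys q₀ j.succ.castSucc).prodMk
      (DiscreteControl.contMDiff_eval (fun i => 𝓘(ℝ, EU i)) 1 j.succ))
    (DiscreteControl.contMDiff_state sys q₀ (Fin.last (m + 1)))
    hreg.initial hreg.mid hreg.final
    (DiscreteControl.IsStrictlyNormal.eq_zero sys q₀ hnormal)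
  -- `penalty` puts the final term before the sum of mixed terms, the criterion after it.
  have h' : DiscreteControl.penalty sys Φ q₀ = fun e u =>
      Φ.initial e (u 0) + ∑ j, Φ.mid j e (sys.state q₀ u j.succ.castSucc, u j.succ) +
        Φ.final e (sys.state q₀ u (Fin.last (m + 1))) :=
    funext fun e => funext fun u => add_right_comm _ _ _
  rw [h']
  exact h
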